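/- Let $n\ge 1$, $0\le k\le n$, $s=\min(k,n-k)$, let $X$ be the set of $k$-subsets of $\{1,\dots,n\}$ and let $\mathcal F$ be the space of functions $X\to\mathbb C$, with the inner product for which the delta functions $\delta(x)$, $x\in X$, are orthonormal, and with the action $\sigma f=f\circ\sigma^{-1}$ of $S_n$. For $j\le n$ let $S_j\subseteq S_n$ be the subgroup that fixes $j+1,\dots,n$, and for a Young diagram $\lambda$ with $j$ boxes let $\mathcal F_{j,\lambda}$ be the isotypic component of $\mathcal F$, as an $S_j$-module, for the irreducible representation $V_\lambda$ of $S_j$. For a set $w\subseteq\{i+1,\dots,n\}$ let $\mathcal F^w$ be the span of the $\delta(x)$ with $x\cap\{i+1,\dots,n\}=w$. Let $B_0=B_1$ be the basis of delta functions, and for $2\le i\le n$ let $B_i$ be an orthonormal basis of $\mathcal F$ each of whose elements lies in a space $\mathcal F_{1,\lambda_1}\cap\dots\cap\mathcal F_{i,\lambda_i}\cap\mathcal F^{w}$ for some path $\lambda_1\nearrow\dots\nearrow\lambda_i$ in the Young graph starting at the one-box diagram and some $w\subseteq\{i+1,\dots,n\}$ (these spaces have dimension at most one, so $B_i$ is determined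 up to order and scalars of modulus one; $B_n$ is a Gelfand–Tsetlin basis of $\mathcal F$). Let $[B_{i-1}]_{B_i}$ be the change of basis matrix, so that $[f]_{B_i}=[B_{i-1}]_{B_i}[f]_{B_{i-1}}$. For $0\le a\le s$ let $\mathcal F_a=\mathcal F_{n,(n-a,a)}$; then $\mathcal F=\bigoplus_{a=0}^s\mathcal F_a$ orthogonally. For $f\in\mathcal F$ write $f=\sum_{a=0}^s f_a$ with $f_a\in\mathcal F_a$, and for $H\subseteq\{0,\dots,s\}$ put $f_H=\sum_{a\in H}f_a$. **Theorem.** Assume that the matrices $[B_{i-1}]_{B_i}$, $i=2,\dots,n$, are known. Then for every $H\subseteq\{0,\dots,s\}$ the column vector $[f_H]_{B_0}$ can be computed from the column vector $[f]_{B_0}$, $f\in\mathcal F$, with at most $4(n-1)\binom nk$ operations. That is, there is an arithmetic circuit, independent of $f$, with at most $4(n-1)\binom nk$ operations $(u,v,w)\mapsto uv+w$ (a complex multiplication and addition counts as one operation), whose only constants are $0$, $1$ and the entries of the unitary matrices $[B_{i-1}]_{B_i}$ and of their inverses $[B_i]_{B_{i-1}}$, $2\le i\le n$, that maps $[f]_{B_0}$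 to $[f_H]_{B_0}$ for every $f\in\mathcal F$. -/

import Mathlib

noncomputable section

namespace Johnson

open Equiv

/-! ### Functions on the Johnson graph -/

/-- The set `X` of `k`-subsets of an `n`-set; the places `1, …, n` are `0, …, n - 1` in `Fin n`. -/
abbrev X (n k : ℕ) : Type := Set.powersetCard (Fin n) k

/-- The complex functions on `X`, with the inner product that makes the delta functions
orthonormal. -/
abbrev F (n k : ℕ) : Type := EuclideanSpace ℂ (X n k)

/-- The orthonormal basis of delta functions. -/
def deltaBasis (n k : ℕ) : OrthonormalBasis (X n k) ℂ (F n k) :=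
  EuclideanSpace.basisFun (X n k) ℂ

/-- The representation of `S_n` on `F n k`, given by `σ f = f ∘ σ⁻¹`. -/
def rep (n k : ℕ) : Representation ℂ (Perm (Fin n)) (F n k) where
  toFun σ :=
    { toFun := fun f => WithLp.toLp 2 fun x => f (σ⁻¹ • x)
      map_add' := fun _ _ => rfl
      map_smul' := fun _ _ => rfl }
  map_one' := by
    ext f x
    simp
  map_mul' σ τ := by
    ext f x
    change f ((σ * τ)⁻¹ • x) = f (τ⁻¹ • σ⁻¹ • x)
    rw [mul_inv_rev, mul_smul]

/-- `F n k` as a representation of `S_j`, which permutes the first `j` places and fixes the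
last `n - j` ones. -/
def repRestrict (n k : ℕ) {j : ℕ} (hj : j ≤ n) : Representation ℂ (Perm (Fin j)) (F n k) :=
  (rep n k).comp (Perm.viaEmbeddingHom (Fin.castLEEmb hj))

/-! ### The irreducible representations of the symmetric group -/

/-- A Young tableau of shape `μ` (a bijective filling, not necessarily standard):
`t p` is the box `(row, column)` that holds `p`. -/
abbrev Tableau (j : ℕ) (μ : YoungDiagram) : Type := Fin j ≃ μ.cells

open Classical in
/-- The Young symmetrizer of `t`: the sum of the permutations that preserve the rows of `t` times
the signed sum of the permutations that preserve the columns of `t`. -/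
def youngSymmetrizer {j : ℕ} {μ : YoungDiagram} (t : Tableau j μ) :
    MonoidAlgebra ℂ (Perm (Fin j)) :=
  (∑ σ : Perm (Fin j) with ∀ p, (t (σ p)).1.1 = (t p).1.1, MonoidAlgebra.single σ 1) *
    (∑ τ : Perm (Fin j) with ∀ p, (t (τ p)).1.2 = (t p).1.2,
      MonoidAlgebra.single τ ((Perm.sign τ : ℤ) : ℂ))

/-- The irreducible representation `V_μ` of `S_j` attached to the Young diagram `μ` with `j` boxes,
as the left ideal of the group algebra generated by the Young symmetrizer of a tableau `t` of
shape `μ`. Its isomorphism class does not depend on `t`. -/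
def specht {j : ℕ} {μ : YoungDiagram} (t : Tableau j μ) :
    Ideal (MonoidAlgebra ℂ (Perm (Fin j))) :=
  Ideal.span {youngSymmetrizer t}

/-- The isotypic component `F_{j,μ}` of `F n k`, as an `S_j`-module, for the irreducible
representation `V_μ`. All tableaux `t` of shape `μ` give the same component; the supremum only
avoids to choose one. -/
def isotypic (n k : ℕ) {j : ℕ} (hj : j ≤ n) (μ : YoungDiagram) : Submodule ℂ (F n k) :=
  ⨆ t : Tableau j μ,
    ((isotypicComponent (MonoidAlgebra ℂ (Perm (Fin j))) (repRestrict n k hj).asModule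
      (specht t)).restrictScalars ℂ).map (repRestrict n k hj).asModuleEquiv.toLinearMap

/-! ### The intermediate bases -/

/-- `l 1 ↗ l 2 ↗ ⋯ ↗ l i` is a path in the Young graph that starts at the one-box diagram,
that is, a standard Young tableau with `i` boxes. -/
def IsYoungChain (i : ℕ) (l : ℕ → YoungDiagram) : Prop :=
  (∀ j, 1 ≤ j → j ≤ i → (l j).card = j) ∧ ∀ j, 1 ≤ j → j < i → l j ≤ l (j + 1)

/-- The space `F^w` spanned by the delta functions of the `k`-sets `x` whose word ends in `w`.
The word `w`, on the last `n - i` places, is given by the places that carry the letter `1`;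
what `w` says about the first `i` places is ignored. -/
def suffixSpace (n k i : ℕ) (w : Set (Fin n)) : Submodule ℂ (F n k) :=
  Submodule.span ℂ (deltaBasis n k '' {x | ∀ p : Fin n, i ≤ p.val → (p ∈ x.1 ↔ p ∈ w)})

/-- The Gelfand–Tsetlin space
`F^w_{l 1 ↗ ⋯ ↗ l i} = F_{1, l 1} ∩ ⋯ ∩ F_{i, l i} ∩ F^w`. -/
def gtSpace (n k : ℕ) {i : ℕ} (hi : i ≤ n) (l : ℕ → YoungDiagram) (w : Set (Fin n)) :
    Submodule ℂ (F n k) :=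
  (⨅ (j : ℕ) (_ : 1 ≤ j) (hj : j ≤ i), isotypic n k (hj.trans hi) (l j)) ⊓ suffixSpace n k i w

/-- `B 0, B 1, …, B n` are the bases `B_0, …, B_n`: `B 0` is the delta basis, and for
`1 ≤ i ≤ n` every element of the orthonormal basis `B i` lies in one of the Gelfand–Tsetlin
spaces of level `i`. These are pairwise orthogonal lines (or zero), so this determines `B i` up
to order and scalars of modulus one. For `i = 1` the lines are those of the delta
functions, and `B 1` is normalized to be the delta basis itself. `X n k` serves as the index
set of all of these bases. -/
structure IsIntermediateBases {n k : ℕ}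
    (B : ℕ → OrthonormalBasis (X n k) ℂ (F n k)) : Prop where
  zero : B 0 = deltaBasis n k
  one : B 1 = deltaBasis n k
  gelfandTsetlin : ∀ (i : ℕ) (_ : 1 ≤ i) (hi : i ≤ n) (x : X n k),
    ∃ (l : ℕ → YoungDiagram) (w : Set (Fin n)), IsYoungChain i l ∧ B i x ∈ gtSpace n k hi l w

/-- The change of basis matrix `[B]_{B'}`, so that `[f]_{B'} = [B]_{B'} [f]_B`. -/
def changeOfBasis {n k : ℕ} (B B' : OrthonormalBasis (X n k) ℂ (F n k)) :
    Matrix (X n k) (X n k) ℂ :=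
  B'.toBasis.toMatrix B

/-! ### The isotypic components of a function -/

/-- The Young diagram `(p, q)`. -/
def twoRow (p q : ℕ) (h : q ≤ p) : YoungDiagram :=
  YoungDiagram.ofRowLens [p, q] (by simp [List.sortedGE_iff_pairwise, h])

/-- The isotypic component `F_a` of `F n k` for the Young diagram `(n - a, a)`, where
`0 ≤ a ≤ s = min k (n - k)`. -/
def component (n k : ℕ) (a : Fin (min k (n - k) + 1)) : Submodule ℂ (F n k) :=
  isotypic n k le_rfl (twoRow (n - a) a (by have := a.2; omega))

/-- `f_H`, the sum over `a ∈ H` of the components `f_a` of `f` in the orthogonal decomposition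
`F = F_0 ⊕ ⋯ ⊕ F_s`. -/
def part {n k : ℕ} (H : Finset (Fin (min k (n - k) + 1))) (f : F n k) : F n k :=
  ∑ a ∈ H, (component n k a).starProjection f

/-! ### Arithmetic circuits -/

/-- What an instruction can read: an input coordinate, a constant, or the result of the
instruction number `j` (counted from `0`). -/
inductive Operand (ι : Type)
  | input (x : ι)
  | const (c : ℂ)
  | result (j : ℕ)

/-- The value of an operand on the input `v` when `mem` lists the results computed so far.
(A reference to a result not computed yet reads `0`.) -/
def Operand.eval {ι : Type} (v : ι → ℂ) (mem : List ℂ) : Operand ι → ℂ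
  | .input x => v x
  | .const c => c
  | .result j => mem.getD j 0

/-- One operation: a multiplication and an addition, `a * b + c`. -/
structure Instruction (ι : Type) where
  a : Operand ι
  b : Operand ι
  c : Operand ι

/-- An arithmetic circuit, as a straight-line program: a list of operations, and an operand for
every coordinate of the output. -/
structure Circuit (ι κ : Type) where
  instructions : List (Instruction ι)
  output : κ → Operand ι

namespace Circuit

variable {ι κ : Type}

/-- The results of the instructions, in order. -/
def results (P : Circuit ι κ) (v : ι → ℂ) : List ℂ :=
  P.instructions.foldl
    (fun mem I => mem ++ [I.a.eval v mem * I.b.eval v mem + I.c.eval v mem]) []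

/-- The output of the circuit on the input `v`. -/
def eval (P : Circuit ι κ) (v : ι → ℂ) : κ → ℂ :=
  fun y => (P.output y).eval v (P.results v)

/-- The number of operations. -/
def cost (P : Circuit ι κ) : ℕ := P.instructions.length

/-- All constants that occur in the circuit belong to `K`. -/
def ConstantsIn (P : Circuit ι κ) (K : Set ℂ) : Prop :=
  (∀ I ∈ P.instructions, ∀ c : ℂ,
    I.a = .const c ∨ I.b = .const c ∨ I.c = .const c → c ∈ K) ∧
  ∀ (y : κ) (c : ℂ), P.output y = .const c → c ∈ K

end Circuit

/-- The constants available once the matrices `[B_{i-1}]_{B_i}`, `2 ≤ i ≤ n`, are known: `0`, `1`,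
the entries of these unitary matrices, and those of their inverses `[B_i]_{B_{i-1}}`, which are
their conjugate transposes. -/
def knownConstants {n k : ℕ} (B : ℕ → OrthonormalBasis (X n k) ℂ (F n k)) : Set ℂ :=
  {0, 1} ∪ {c | ∃ i, 2 ≤ i ∧ i ≤ n ∧ ∃ x y, c = changeOfBasis (B (i - 1)) (B i) x y ∨
    c = changeOfBasis (B i) (B (i - 1)) x y}

end Johnson

end

/-! The components are read off in `B n`: each of its vectors lies in one `component` or is
orthogonal to it, so passing from `f` to `f_H` only replaces some coordinates by zero, which is free
(`IsIntermediateBases.repr_part`). It remains to go from `B 1`, the delta basis, up to `B n` and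
back. These are `n - 1` changes of basis each way, and each costs at most two operations per row if
every row of the matrix has at most two nonzero entries (`Computes.mulVec`). Total: `4 (n - 1) *
n.choose k`.

For sparsity, isotypic components are replaced by eigenspaces. The sum of all transpositions of
`S_j` is central and acts on `V_μ` by the scalar `contentSum μ`, so Gelfand–Tsetlin vectors are
joint eigenvectors of the symmetric operators `swapSum`. A vector of level `i` and one of level `i +
1` that are not orthogonal share their eigenvalues up to level `i` and their suffix beyond the place
`i`. For fixed data these vectors lie in the sum of two Gelfand–Tsetlin spaces of level `i`, one for
each letter at the place `i`. As those are at most lines, the sum has dimension at most two, which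
bounds the rows of the matrix and of its inverse.

That they are at most lines goes by induction on `i`: a plane at level `i + 1` would contain a
vector for each letter, both with the same Jucys–Murphy eigenvalue, and `eq_zero_of_jucysMurphy_eq`
excludes this by the commutation relation of raising and lowering operators.

In the top level, diagrams with three rows do not occur (`isotypic_eq_bot`), and those with at most
two rows are separated by `contentSum` (`eq_of_contentSum_eq`). -/

noncomputable section

namespace Johnson

open Equiv
open scoped Pointwise

/-! ### Composing circuits -/

namespace Circuit

variable {ι κ κ' : Type}

/-- The results of a list of instructions that is run after `mem` has been computed. -/
def run (v : ι → ℂ) (L : List (Instruction ι)) (mem : List ℂ) : List ℂ :=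
  L.foldl (fun mem I => mem ++ [I.a.eval v mem * I.b.eval v mem + I.c.eval v mem]) mem

theorem length_run (v : ι → ℂ) (L : List (Instruction ι)) (mem : List ℂ) :
    (run v L mem).length = mem.length + L.length := by
  induction L generalizing mem with
  | nil => simp [run]
  | cons I L ih =>
    have := ih (mem ++ [I.a.eval v mem * I.b.eval v mem + I.c.eval v mem])
    simp only [run, List.foldl_cons, List.length_append, List.length_cons, List.length_nil] at this ⊢
    omega

theorem length_results (P : Circuit ι κ) (v : ι → ℂ) : (P.results v).length = P.cost := by
  have := length_run v P.instructions []
  simpa [run, results, cost] using this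

/-- An operand that does not refer to results beyond the first `m` ones. -/
def _root_.Johnson.Operand.IsBelow (m : ℕ) (o : Operand ι) : Prop :=
  ∀ j, o = .result j → j < m

theorem _root_.Johnson.Operand.IsBelow.mono {m m' : ℕ} {o : Operand ι} (h : o.IsBelow m)
    (hm : m ≤ m') : o.IsBelow m' :=
  fun j hj => (h j hj).trans_le hm

/-- The bound matters: an operand that points past the end reads the default `0`, and its value
could change when instructions are appended. -/
theorem _root_.Johnson.Operand.IsBelow.eval_append {o : Operand ι} {v : ι → ℂ} {mem : List ℂ}
    (h : o.IsBelow mem.length) (mem' : List ℂ) : o.eval v (mem ++ mem') = o.eval v mem := by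
  cases o with
  | input x => rfl
  | const c => rfl
  | result j =>
    have : j < mem.length := h j rfl
    simp [Operand.eval, List.getD_eq_getElem?_getD, List.getElem?_append_left this]

/-- There is a circuit with constants in `K` and `m` operations that computes `g`. -/
def Computes (K : Set ℂ) (m : ℕ) (g : (ι → ℂ) → κ → ℂ) : Prop :=
  ∃ P : Circuit ι κ, P.ConstantsIn K ∧ P.cost = m ∧ (∀ y, (P.output y).IsBelow m) ∧
    ∀ v, P.eval v = g v

theorem computes_id (K : Set ℂ) : Computes K 0 (fun v : ι → ℂ => v) :=
  ⟨⟨[], fun x => .input x⟩, ⟨by simp, by simp⟩, rfl, fun y j h => by simp at h, fun v => rfl⟩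

/-- Rearranging the outputs, or replacing them by zero, is free. -/
theorem Computes.select {K : Set ℂ} {m : ℕ} {g : (ι → ℂ) → κ → ℂ} (h : Computes K m g)
    (h0 : 0 ∈ K) (s : κ' → Option κ) :
    Computes K m (fun v y => ((s y).map (g v)).getD 0) := by
  obtain ⟨P, hK, hm, hb, he⟩ := h
  refine ⟨⟨P.instructions, fun y => ((s y).map P.output).getD (.const 0)⟩, ⟨hK.1, ?_⟩, hm, ?_, ?_⟩
  · intro y c hc
    cases hs : s y with
    | none =>
      simp only [hs, Option.map_none, Option.getD_none, Operand.const.injEq] at hc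
      exact hc ▸ h0
    | some z =>
      simp only [hs, Option.map_some, Option.getD_some] at hc
      exact hK.2 z c hc
  · intro y j hj
    cases hs : s y with
    | none => simp [hs] at hj
    | some z =>
      simp only [hs, Option.map_some, Option.getD_some] at hj
      exact hb z j hj
  · intro v
    funext y
    cases hs : s y with
    | none => simp [eval, hs, Operand.eval]
    | some z => simp [← he v, eval, hs, results]

/-- One more operation computes `c * g y + g z`, or `c * g y`, for a constant `c`. -/
theorem Computes.mulAdd {K : Set ℂ} {m : ℕ} {g : (ι → ℂ) → κ → ℂ} (h : Computes K m g)
    {c : ℂ} (hc : c ∈ K) (h0 : 0 ∈ K) (y : κ) (z : Option κ) :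
    Computes K (m + 1) (fun v (o : Option κ) =>
      o.elim (c * g v y + (z.map (g v)).getD 0) (g v)) := by
  obtain ⟨P, hK, hm, hb, he⟩ := h
  let I : Instruction ι := ⟨.const c, P.output y, (z.map P.output).getD (.const 0)⟩
  have hres (v : ι → ℂ) (Q : Option κ → Operand ι) :
      (Circuit.mk (P.instructions ++ [I]) Q).results v = P.results v ++
        [I.a.eval v (P.results v) * I.b.eval v (P.results v) + I.c.eval v (P.results v)] := by
    simp [results]
  refine ⟨⟨P.instructions ++ [I], fun o => o.elim (.result m) P.output⟩, ⟨?_, ?_⟩, ?_, ?_, ?_⟩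
  · intro J hJ d hd
    rcases List.mem_append.1 hJ with hJ | hJ
    · exact hK.1 J hJ d hd
    · obtain rfl : J = I := by simpa using hJ
      rcases hd with hd | hd | hd
      · have : c = d := by simpa [I] using hd
        exact this ▸ hc
      · exact hK.2 y d hd
      · cases z with
        | none =>
          have : 0 = d := by simpa [I] using hd
          exact this ▸ h0
        | some z => exact hK.2 z d (by simpa [I] using hd)
  · rintro (_ | o) d hd
    · simp at hd
    · exact hK.2 o d hd
  · simpa [cost] using hm
  · rintro (_ | o) j hj
    · have : m = j := by simpa using hj
      omega
    · exact ((hb o).mono (Nat.le_succ m)) j hj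
  · intro v
    have hlen := (P.length_results v).trans hm
    funext o
    rw [eval, hres]
    cases o with
    | none =>
      have h1 : (P.output y).eval v (P.results v) = g v y := congrFun (he v) y
      have h2 : ((z.map P.output).getD (.const 0)).eval v (P.results v) =
          (z.map (g v)).getD 0 := by
        cases z with
        | none => rfl
        | some z => exact congrFun (he v) z
      have h3 : ∀ r : ℂ, (P.results v ++ [r]).getD m 0 = r := by
        intro r
        simp [List.getD_eq_getElem?_getD, ← hlen]
      have h4 : ∀ mem, (Operand.const c : Operand ι).eval v mem = c := fun _ => rfl
      simp only [I, h1, h2, h4]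
      exact h3 _
    | some o =>
      simp only [Option.elim]
      rw [Operand.IsBelow.eval_append (by rw [hlen]; exact hb o)]
      exact congrFun (he v) o

-- Rows with fewer than two nonzero entries are padded with the coefficient `0`, so that all rows
-- cost the same; `Nonempty κ` supplies a dummy index.
open Classical in
theorem exists_mulVec_eq_of_card_le_two [Fintype κ] [Nonempty κ] {K : Set ℂ} (h0 : 0 ∈ K)
    (M : Matrix κ' κ ℂ) (hM : ∀ x y, M x y ∈ K) (x : κ')
    (hx : (Finset.univ.filter fun y => M x y ≠ 0).card ≤ 2) :
    ∃ c ∈ K, ∃ c' ∈ K, ∃ y z, ∀ u : κ → ℂ, M.mulVec u x = c * u y + c' * u z := by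
  have key (u : κ → ℂ) : M.mulVec u x =
      ∑ y ∈ Finset.univ.filter (fun y => M x y ≠ 0), M x y * u y := by
    rw [Finset.sum_filter_of_ne]
    · rfl
    · intro y _ h
      exact left_ne_zero_of_mul h
  simp only [key]
  generalize Finset.univ.filter (fun y => M x y ≠ 0) = S at hx
  have hcard : S.card = 0 ∨ S.card = 1 ∨ S.card = 2 := by omega
  obtain ⟨y₀⟩ := ‹Nonempty κ›
  rcases hcard with h | h | h
  · obtain rfl := Finset.card_eq_zero.1 h
    exact ⟨0, h0, 0, h0, y₀, y₀, by simp⟩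
  · obtain ⟨y, rfl⟩ := Finset.card_eq_one.1 h
    exact ⟨M x y, hM x y, 0, h0, y, y, by simp⟩
  · obtain ⟨y, z, hyz, rfl⟩ := Finset.card_eq_two.1 h
    exact ⟨M x y, hM x y, M x z, hM x z, y, z, fun u => Finset.sum_pair hyz⟩

open Classical in
/-- A matrix all of whose rows have at most two nonzero entries is applied with two operations
for each row. -/
theorem Computes.mulVec [Fintype κ] [Nonempty κ] [Fintype κ'] {K : Set ℂ} {m : ℕ}
    {g : (ι → ℂ) → κ → ℂ} (h : Computes K m g) (h0 : 0 ∈ K) (M : Matrix κ' κ ℂ)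
    (hM : ∀ x y, M x y ∈ K) (hrow : ∀ x, (Finset.univ.filter fun y => M x y ≠ 0).card ≤ 2) :
    Computes K (m + 2 * Fintype.card κ') (fun v => M.mulVec (g v)) := by
  -- Rows are added one at a time; the entries of `g v` stay among the outputs because later rows
  -- read them again.
  have key (S : Finset κ') : Computes K (m + 2 * S.card) (fun v (o : κ ⊕ κ') =>
      o.elim (g v) (fun x => if x ∈ S then M.mulVec (g v) x else 0)) := by
    induction S using Finset.induction_on with
    | empty =>
      convert h.select h0 (fun o : κ ⊕ κ' => o.elim some (fun _ => none)) using 1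
      · simp
      · funext v o
        cases o <;> simp
    | insert x S hx ih =>
      obtain ⟨c, hc, c', hc', y, z, hcc⟩ := exists_mulVec_eq_of_card_le_two h0 M hM x (hrow x)
      -- The first operation forms `c * u y + 0`, the second adds `c' * u z`; the selection then
      -- drops the intermediate value.
      have := ((ih.mulAdd hc h0 (.inl y) none).mulAdd hc' h0 (some (.inl z)) (some none)).select h0
        (fun o : κ ⊕ κ' => if o = .inr x then some none else some (some (some o)))
      convert this using 1
      · rw [Finset.card_insert_of_notMem hx]
        ring
      · funext v o
        rcases o with o | o
        · simp
        · by_cases ho : o = x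
          · subst ho
            simp [hcc]
            ring
          · simp [ho]
  convert (key Finset.univ).select h0 (fun x => some (.inr x)) using 1
  · simp
  · funext v x
    simp

end Circuit

/-! ### Transpositions and Young symmetrizers -/

theorem eq_zero_of_eq_neg {M : Type*} [AddCommGroup M] [Module ℂ M] {x : M} (h : x = -x) :
    x = 0 := by
  have h2 : (2 : ℂ) • x = 0 := by
    rw [two_smul]
    exact add_eq_zero_iff_eq_neg.2 h
  exact (smul_eq_zero.1 h2).resolve_left two_ne_zero

section YoungSymmetrizer

variable {j : ℕ} {μ : YoungDiagram} (t : Tableau j μ)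

open Classical in
/-- The sum of the permutations that preserve the rows of `t`. -/
def rowSum : MonoidAlgebra ℂ (Perm (Fin j)) :=
  ∑ σ : Perm (Fin j) with ∀ p, (t (σ p)).1.1 = (t p).1.1, MonoidAlgebra.single σ 1

open Classical in
/-- The signed sum of the permutations that preserve the columns of `t`. -/
def colSum : MonoidAlgebra ℂ (Perm (Fin j)) :=
  ∑ τ : Perm (Fin j) with ∀ p, (t (τ p)).1.2 = (t p).1.2,
    MonoidAlgebra.single τ ((Perm.sign τ : ℤ) : ℂ)

/-- The transposition of `p` and `q` as an element of the group algebra. -/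
def transp (p q : Fin j) : MonoidAlgebra ℂ (Perm (Fin j)) := MonoidAlgebra.single (swap p q) 1

theorem youngSymmetrizer_eq : youngSymmetrizer t = rowSum t * colSum t := rfl

theorem transp_comm (p q : Fin j) : transp p q = transp q p := by
  rw [transp, transp, swap_comm]

variable {t}

theorem swap_preserves {β : Type*} {f : Fin j → β} {p q : Fin j} (h : f p = f q) (r : Fin j) :
    f (swap p q r) = f r := by
  rw [swap_apply_def]
  split_ifs with h1 h2
  · rw [h1, h]
  · rw [h2, h]
  · rfl

/-- The transposition lies in the row group, so multiplying by it permutes the summands. For columns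
the same substitution changes every sign. -/
theorem rowSum_mul_transp {p q : Fin j} (h : (t p).1.1 = (t q).1.1) :
    rowSum t * transp p q = rowSum t := by
  classical
  rw [rowSum, transp, Finset.sum_mul]
  refine Finset.sum_bij' (fun σ _ => σ * swap p q) (fun σ _ => σ * swap p q) ?_ ?_ ?_ ?_ ?_
  · intro σ hσ
    simp only [Finset.mem_filter, Finset.mem_univ, true_and] at hσ ⊢
    intro r
    rw [Perm.mul_apply, hσ, swap_preserves (f := fun r => (t r).1.1) h]
  · intro σ hσ
    simp only [Finset.mem_filter, Finset.mem_univ, true_and] at hσ ⊢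
    intro r
    rw [Perm.mul_apply, hσ, swap_preserves (f := fun r => (t r).1.1) h]
  · intro σ _
    simp [mul_assoc]
  · intro σ _
    simp [mul_assoc]
  · intro σ _
    simp [MonoidAlgebra.single_mul_single]

theorem transp_mul_colSum {p q : Fin j} (hpq : p ≠ q) (h : (t p).1.2 = (t q).1.2) :
    transp p q * colSum t = -colSum t := by
  classical
  rw [colSum, transp, Finset.mul_sum, ← Finset.sum_neg_distrib]
  have hs := swap_preserves (f := fun r => (t r).1.2) h
  refine Finset.sum_bij' (fun σ _ => swap p q * σ) (fun σ _ => swap p q * σ) ?_ ?_ ?_ ?_ ?_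
  · intro σ hσ
    simp only [Finset.mem_filter, Finset.mem_univ, true_and] at hσ ⊢
    intro r
    rw [Perm.mul_apply, hs, hσ]
  · intro σ hσ
    simp only [Finset.mem_filter, Finset.mem_univ, true_and] at hσ ⊢
    intro r
    rw [Perm.mul_apply, hs, hσ]
  · intro σ _
    simp [← mul_assoc]
  · intro σ _
    simp [← mul_assoc]
  · intro σ _
    simp [MonoidAlgebra.single_mul_single, Perm.sign_swap hpq, ← MonoidAlgebra.single_neg]

theorem colSum_mul_transp {p q : Fin j} (hpq : p ≠ q) (h : (t p).1.2 = (t q).1.2) :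
    colSum t * transp p q = -colSum t := by
  classical
  rw [colSum, transp, Finset.sum_mul, ← Finset.sum_neg_distrib]
  have hs := swap_preserves (f := fun r => (t r).1.2) h
  refine Finset.sum_bij' (fun σ _ => σ * swap p q) (fun σ _ => σ * swap p q) ?_ ?_ ?_ ?_ ?_
  · intro σ hσ
    simp only [Finset.mem_filter, Finset.mem_univ, true_and] at hσ ⊢
    intro r
    rw [Perm.mul_apply, hσ, hs]
  · intro σ hσ
    simp only [Finset.mem_filter, Finset.mem_univ, true_and] at hσ ⊢
    intro r
    rw [Perm.mul_apply, hσ, hs]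
  · intro σ _
    simp [mul_assoc]
  · intro σ _
    simp [mul_assoc]
  · intro σ _
    simp [MonoidAlgebra.single_mul_single, Perm.sign_swap hpq, ← MonoidAlgebra.single_neg]

/-- A transposition of two boxes in different rows and columns is killed by the two sums. -/
theorem rowSum_mul_transp_mul_colSum_eq_zero {p q : Fin j} (hr : (t p).1.1 ≠ (t q).1.1)
    (hc : (t p).1.2 ≠ (t q).1.2) : rowSum t * transp p q * colSum t = 0 := by
  -- With `p` in the upper row, the box in the row of `p` and the column of `q` belongs to `μ`; `s`
  -- is its entry.
  wlog hlt : (t p).1.1 < (t q).1.1 generalizing p q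
  · rw [transp_comm]
    exact this hr.symm hc.symm (lt_of_le_of_ne (not_lt.1 hlt) hr.symm)
  have hmem : ((t p).1.1, (t q).1.2) ∈ μ.cells := by
    rcases le_total (t p).1.2 (t q).1.2 with h | h
    · exact μ.isLowerSet (show _ ≤ (t q).1 from ⟨hlt.le, le_rfl⟩) (t q).2
    · exact μ.isLowerSet (show _ ≤ (t p).1 from ⟨le_rfl, h⟩) (t p).2
  obtain ⟨s, hs⟩ := t.surjective ⟨_, hmem⟩
  have hs1 : (t p).1.1 = (t s).1.1 := by rw [hs]
  have hs2 : (t s).1.2 = (t q).1.2 := by rw [hs]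
  have hsq : s ≠ q := by
    rintro rfl
    exact hr hs1
  have hsp : s ≠ p := by
    rintro rfl
    exact hc hs2
  have hpq : p ≠ q := by
    rintro rfl
    exact hr rfl
  -- On the left the row sum absorbs `transp p s`, on the right the column sum turns `transp s q`
  -- into `-1`, so the product equals its own negative.
  have hperm : transp p s * transp p q = transp p q * transp s q := by
    rw [transp, transp, transp, MonoidAlgebra.single_mul_single, MonoidAlgebra.single_mul_single]
    congr 1
    ext r
    simp only [Perm.mul_apply, swap_apply_def]
    grind
  have h1 : rowSum t * transp p q * colSum t =
      rowSum t * (transp p s * transp p q) * colSum t := by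
    rw [← mul_assoc, rowSum_mul_transp hs1]
  have h2 : rowSum t * transp p q * colSum t =
      -(rowSum t * (transp p q * transp s q) * colSum t) := by
    rw [← mul_assoc (rowSum t), mul_assoc _ (transp s q), transp_mul_colSum hsq hs2, mul_neg,
      neg_neg]
  rw [hperm] at h1
  rw [← h1] at h2
  exact eq_zero_of_eq_neg h2

/-- The factor by which the transposition of two boxes acts between the row sum and the
column sum. -/
def pairSign (c d : ℕ × ℕ) : ℤ :=
  if c.1 = d.1 then 1 else if c.2 = d.2 then -1 else 0

theorem rowSum_mul_transp_mul_colSum (p q : Fin j) :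
    rowSum t * transp p q * colSum t = (pairSign (t p).1 (t q).1 : ℂ) • youngSymmetrizer t := by
  rw [youngSymmetrizer_eq, pairSign]
  split_ifs with h1 h2
  · simp [rowSum_mul_transp h1]
  · have hpq : p ≠ q := by
      rintro rfl
      exact h1 rfl
    simp [mul_assoc, transp_mul_colSum hpq h2]
  · simp [rowSum_mul_transp_mul_colSum_eq_zero h1 h2]

/-- The sum of all transpositions of an ordered pair. -/
def transpSum (j : ℕ) : MonoidAlgebra ℂ (Perm (Fin j)) := ∑ p, ∑ q, transp p q

theorem transpSum_mul_single (σ : Perm (Fin j)) (c : ℂ) :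
    transpSum j * MonoidAlgebra.single σ c = MonoidAlgebra.single σ c * transpSum j := by
  have h (p q : Fin j) : MonoidAlgebra.single σ c * transp p q =
      transp (σ p) (σ q) * MonoidAlgebra.single σ c := by
    rw [transp, transp, MonoidAlgebra.single_mul_single, MonoidAlgebra.single_mul_single,
      Equiv.mul_swap_eq_swap_mul, one_mul, mul_one]
  simp only [transpSum, Finset.mul_sum, Finset.sum_mul, h]
  rw [← Equiv.sum_comp σ]
  refine Finset.sum_congr rfl fun p _ => ?_
  rw [← Equiv.sum_comp σ]

theorem transpSum_mul_comm (x : MonoidAlgebra ℂ (Perm (Fin j))) :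
    transpSum j * x = x * transpSum j := by
  induction x using MonoidAlgebra.induction_linear with
  | zero => simp
  | add x y hx hy => rw [mul_add, add_mul, hx, hy]
  | single σ c => exact transpSum_mul_single σ c

/-- The eigenvalue of the sum of all transpositions on `V_μ`: up to normalization, the sum of the
contents of the boxes of `μ`. -/
def contentSum (μ : YoungDiagram) : ℤ := ∑ c ∈ μ.cells, ∑ d ∈ μ.cells, pairSign c d

/-- By centrality the sum can be moved between the row sum and the column sum, where each
transposition acts by its `pairSign`. Pairs `p = q` count as the identity, on both sides. -/
theorem transpSum_mul_youngSymmetrizer (t : Tableau j μ) :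
    transpSum j * youngSymmetrizer t = (contentSum μ : ℂ) • youngSymmetrizer t := by
  have h : ∑ p, ∑ q, pairSign (t p).1 (t q).1 = contentSum μ := by
    have hsum (f : ℕ × ℕ → ℤ) : ∑ p, f (t p).1 = ∑ c ∈ μ.cells, f c := by
      rw [← Finset.sum_coe_sort μ.cells f]
      exact Equiv.sum_comp t (fun c => f c.1)
    rw [contentSum, ← hsum]
    exact Finset.sum_congr rfl fun p _ => hsum _
  conv_lhs => rw [youngSymmetrizer_eq, ← mul_assoc, transpSum_mul_comm, transpSum]
  simp only [Finset.mul_sum, Finset.sum_mul, rowSum_mul_transp_mul_colSum, ← Finset.sum_smul]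
  rw [← h]
  push_cast
  rfl

theorem transpSum_mul_of_mem_specht {x : MonoidAlgebra ℂ (Perm (Fin j))}
    (hx : x ∈ specht t) :
    (transpSum j - algebraMap ℂ _ (contentSum μ : ℂ)) * x = 0 := by
  obtain ⟨r, rfl⟩ := Ideal.mem_span_singleton'.1 hx
  rw [sub_mul, ← mul_assoc, transpSum_mul_comm, mul_assoc, transpSum_mul_youngSymmetrizer,
    ← Algebra.smul_def, mul_smul_comm, sub_self]

end YoungSymmetrizer

/-! ### Isotypic components -/

theorem rep_apply (n k : ℕ) (σ : Perm (Fin n)) (f : F n k) (x : X n k) :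
    rep n k σ f x = f (σ⁻¹ • x) := rfl

theorem viaEmbeddingHom_swap {α β : Type*} [DecidableEq α] [DecidableEq β] (e : α ↪ β) (p q : α) :
    Perm.viaEmbeddingHom e (swap p q) = swap (e p) (e q) := by
  ext r
  rw [Perm.viaEmbeddingHom_apply]
  by_cases hr : r ∈ Set.range e
  · obtain ⟨r, rfl⟩ := hr
    rw [Perm.viaEmbedding_apply]
    exact (e.injective.swap_apply p q r).symm
  · rw [Perm.viaEmbedding_apply_of_notMem _ _ _ hr, swap_apply_of_ne_of_ne]
    · rintro rfl
      exact hr ⟨p, rfl⟩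
    · rintro rfl
      exact hr ⟨q, rfl⟩

/-- The sum of the transpositions of all ordered pairs of the first `j` places. -/
def swapSum (n k : ℕ) {j : ℕ} (hj : j ≤ n) : F n k →ₗ[ℂ] F n k :=
  ∑ p : Fin j, ∑ q : Fin j, rep n k (swap (p.castLE hj) (q.castLE hj))

theorem asAlgebraHom_transp (n k : ℕ) {j : ℕ} (hj : j ≤ n) (p q : Fin j) :
    (repRestrict n k hj).asAlgebraHom (transp p q) =
      rep n k (swap (p.castLE hj) (q.castLE hj)) := by
  rw [transp, Representation.asAlgebraHom_single, one_smul]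
  exact congrArg (rep n k) (viaEmbeddingHom_swap (Fin.castLEEmb hj) p q)

theorem asAlgebraHom_transpSum (n k : ℕ) {j : ℕ} (hj : j ≤ n) :
    (repRestrict n k hj).asAlgebraHom (transpSum j) = swapSum n k hj := by
  simp only [transpSum, swapSum, map_sum, asAlgebraHom_transp]

/-- An element of the ring that commutes with everything and kills `V` also kills the
isotypic component of `V`. -/
theorem smul_eq_zero_of_mem_isotypicComponent {R M S : Type*} [Ring R] [AddCommGroup M] [Module R M]
    [AddCommGroup S] [Module R S] {z : R} (hz : ∀ r, z * r = r * z) (hS : ∀ s : S, z • s = 0)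
    {v : M} (hv : v ∈ isotypicComponent R M S) : z • v = 0 := by
  let N : Submodule R M :=
    { carrier := {v | z • v = 0}
      add_mem' := by
        intro v w hv hw
        simp only [Set.mem_ofPred_eq] at hv hw ⊢
        rw [smul_add, hv, hw, add_zero]
      zero_mem' := smul_zero z
      smul_mem' := by
        intro r v hv
        simp only [Set.mem_ofPred_eq] at hv ⊢
        rw [← mul_smul, hz, mul_smul, hv, smul_zero] }
  have hN : isotypicComponent R M S ≤ N := by
    refine sSup_le ?_
    rintro m ⟨e⟩ w hw
    have h : z • (⟨w, hw⟩ : m) = 0 := by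
      apply e.injective
      rw [map_smul, hS, map_zero]
    exact congrArg Subtype.val h
  exact hN hv

/-- Together with `isotypic_eq_bot`, this is all that is needed about isotypic components:
`transpSum j` minus the scalar is central and kills the Specht ideal, hence every copy of it. -/
theorem isotypic_le_eigenspace (n k : ℕ) {j : ℕ} (hj : j ≤ n) (μ : YoungDiagram) :
    isotypic n k hj μ ≤ Module.End.eigenspace (swapSum n k hj) (contentSum μ : ℂ) := by
  refine iSup_le fun t => ?_
  rintro _ ⟨v, hv, rfl⟩
  have h := smul_eq_zero_of_mem_isotypicComponent
    (z := transpSum j - algebraMap ℂ _ (contentSum μ : ℂ))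
    (fun r => by rw [sub_mul, mul_sub, transpSum_mul_comm, Algebra.commutes])
    (fun s => Subtype.ext (transpSum_mul_of_mem_specht s.2)) hv
  rw [Module.End.mem_eigenspace_iff]
  have h' := congrArg (repRestrict n k hj).asModuleEquiv h
  rw [Representation.asModuleEquiv_map_smul, map_sub, map_zero, asAlgebraHom_transpSum,
    AlgHom.commutes, LinearMap.sub_apply, sub_eq_zero] at h'
  exact h'

theorem mem_smul_iff {n k : ℕ} (σ : Perm (Fin n)) (x : X n k) (p : Fin n) :
    p ∈ (σ • x).1 ↔ σ⁻¹ p ∈ x.1 := by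
  change p ∈ σ • x.1 ↔ _
  rw [← Finset.inv_smul_mem_iff]
  rfl

theorem swap_smul_eq_self {n k : ℕ} {p q : Fin n} {x : X n k} (h : p ∈ x.1 ↔ q ∈ x.1) :
    swap p q • x = x := by
  ext r
  rw [mem_smul_iff, swap_inv, swap_apply_def]
  split_ifs with h1 h2
  · rw [h1, h]
  · rw [h2, h]
  · rfl

theorem rep_deltaBasis_of_smul_eq {n k : ℕ} {σ : Perm (Fin n)} {x : X n k} (h : σ • x = x) :
    rep n k σ (deltaBasis n k x) = deltaBasis n k x := by
  ext y
  have : σ⁻¹ • y = x ↔ y = x := by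
    rw [inv_smul_eq_iff, h]
  simp [rep_apply, deltaBasis, EuclideanSpace.basisFun_apply, PiLp.single_apply, this]

/-- The signed column sum of a tableau with at least three rows kills `F n k`. -/
theorem asAlgebraHom_colSum_eq_zero (n k : ℕ) {j : ℕ} (hj : j ≤ n) {μ : YoungDiagram}
    (hμ : (2, 0) ∈ μ) (t : Tableau j μ) :
    (repRestrict n k hj).asAlgebraHom (colSum t) = 0 := by
  have h0 : (0, 0) ∈ μ.cells := μ.isLowerSet (show ((0, 0) : ℕ × ℕ) ≤ (2, 0) by simp) hμ
  have h1 : (1, 0) ∈ μ.cells := μ.isLowerSet (show ((1, 0) : ℕ × ℕ) ≤ (2, 0) by simp) hμ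
  obtain ⟨p, hp⟩ := t.surjective ⟨_, h0⟩
  obtain ⟨q, hq⟩ := t.surjective ⟨_, h1⟩
  obtain ⟨r, hr⟩ := t.surjective ⟨_, hμ⟩
  -- If two entries of one column are places with the same letter, their transposition fixes `x` but
  -- negates the column sum.
  have key {p q : Fin j} (hpq : p ≠ q) (hc : (t p).1.2 = (t q).1.2) {x : X n k}
      (hx : p.castLE hj ∈ x.1 ↔ q.castLE hj ∈ x.1) :
      (repRestrict n k hj).asAlgebraHom (colSum t) (deltaBasis n k x) = 0 := by
    have h := congrArg (fun u => (repRestrict n k hj).asAlgebraHom u (deltaBasis n k x))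
      (colSum_mul_transp hpq hc)
    simp only [map_mul, Module.End.mul_apply, asAlgebraHom_transp, map_neg, LinearMap.neg_apply,
      rep_deltaBasis_of_smul_eq (swap_smul_eq_self hx)] at h
    exact eq_zero_of_eq_neg h
  refine (deltaBasis n k).toBasis.ext fun x => ?_
  rw [OrthonormalBasis.coe_toBasis, LinearMap.zero_apply]
  have hpq : p ≠ q := by
    rintro rfl
    simp [hp] at hq
  have hpr : p ≠ r := by
    rintro rfl
    simp [hp] at hr
  have hqr : q ≠ r := by
    rintro rfl
    simp [hq] at hr
  -- Pigeonhole: three places carry only two letters, so two of them agree.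
  by_cases h1 : p.castLE hj ∈ x.1 ↔ q.castLE hj ∈ x.1
  · exact key hpq (by rw [hp, hq]) h1
  by_cases h2 : p.castLE hj ∈ x.1 ↔ r.castLE hj ∈ x.1
  · exact key hpr (by rw [hp, hr]) h2
  · exact key hqr (by rw [hq, hr]) (by tauto)

/-- Only diagrams with at most two rows occur in `F n k`. -/
theorem isotypic_eq_bot (n k : ℕ) {j : ℕ} (hj : j ≤ n) {μ : YoungDiagram} (hμ : (2, 0) ∈ μ) :
    isotypic n k hj μ = ⊥ := by
  refine le_bot_iff.1 (iSup_le fun t => ?_)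
  suffices h : isotypicComponent (MonoidAlgebra ℂ (Perm (Fin j))) (repRestrict n k hj).asModule
      (specht t) = ⊥ by
    rw [h]
    rintro _ ⟨v, hv, rfl⟩
    have : v = 0 := hv
    simp [this]
  refine le_bot_iff.1 (sSup_le ?_)
  rintro m ⟨e⟩ w hw
  -- By semisimplicity the embedding of the Specht ideal extends to a map `g` on the whole group
  -- algebra. Thus `w = g (r * youngSymmetrizer t) = r • youngSymmetrizer t • g 1`, which vanishes
  -- since the symmetrizer kills the module.
  obtain ⟨g, hg⟩ := IsSemisimpleModule.extension_property (specht t).subtype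
    (specht t).injective_subtype (m.subtype ∘ₗ e.symm.toLinearMap)
  have hkill (v : (repRestrict n k hj).asModule) : youngSymmetrizer t • v = 0 := by
    apply (repRestrict n k hj).asModuleEquiv.injective
    rw [Representation.asModuleEquiv_map_smul, youngSymmetrizer_eq, map_mul,
      asAlgebraHom_colSum_eq_zero n k hj hμ t, mul_zero, LinearMap.zero_apply, map_zero]
  obtain ⟨r, hr⟩ := Ideal.mem_span_singleton'.1 (e ⟨w, hw⟩).2
  have h1 : g (e ⟨w, hw⟩).1 = w := by
    have := LinearMap.congr_fun hg (e ⟨w, hw⟩)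
    simpa using this
  rw [Submodule.mem_bot, ← h1, ← hr, ← mul_one (r * youngSymmetrizer t), ← smul_eq_mul, map_smul,
    mul_smul, hkill, smul_zero]

/-! ### Two-row diagrams -/

theorem sum_cells_of_two_rows {M : Type*} [AddCommMonoid M] {μ : YoungDiagram} (hμ : (2, 0) ∉ μ)
    (f : ℕ × ℕ → M) : ∑ c ∈ μ.cells, f c =
      ∑ i ∈ Finset.range (μ.rowLen 0), f (0, i) + ∑ i ∈ Finset.range (μ.rowLen 1), f (1, i) := by
  have hcells : μ.cells = ({0} ×ˢ Finset.range (μ.rowLen 0)).disjUnion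
      ({1} ×ˢ Finset.range (μ.rowLen 1)) (by
        rw [Finset.disjoint_left]
        rintro ⟨a, b⟩ h1 h2
        simp only [Finset.mem_product, Finset.mem_singleton] at h1 h2
        omega) := by
    ext ⟨a, b⟩
    simp only [YoungDiagram.mem_cells, Finset.mem_disjUnion, Finset.mem_product,
      Finset.mem_singleton, Finset.mem_range]
    constructor
    · intro h
      have ha : a < 2 := by
        by_contra ha
        exact hμ (μ.isLowerSet (show ((2, 0) : ℕ × ℕ) ≤ (a, b) from ⟨not_lt.1 ha, b.zero_le⟩) h)
      interval_cases a
      · exact .inl ⟨rfl, YoungDiagram.mem_iff_lt_rowLen.1 h⟩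
      · exact .inr ⟨rfl, YoungDiagram.mem_iff_lt_rowLen.1 h⟩
    · rintro (⟨rfl, h⟩ | ⟨rfl, h⟩)
      · exact YoungDiagram.mem_iff_lt_rowLen.2 h
      · exact YoungDiagram.mem_iff_lt_rowLen.2 h
  rw [hcells, Finset.sum_disjUnion, Finset.sum_product, Finset.sum_product]
  simp

theorem card_of_two_rows {μ : YoungDiagram} (hμ : (2, 0) ∉ μ) :
    μ.card = μ.rowLen 0 + μ.rowLen 1 := by
  have := sum_cells_of_two_rows hμ (fun _ => 1)
  simpa [YoungDiagram.card] using this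

/-- The squares count ordered pairs within a row; each of the `rowLen 1` columns of height two
contributes `-1` in either order. -/
theorem contentSum_of_two_rows {μ : YoungDiagram} (hμ : (2, 0) ∉ μ) :
    contentSum μ = (μ.rowLen 0 : ℤ) ^ 2 + (μ.rowLen 1 : ℤ) ^ 2 - 2 * μ.rowLen 1 := by
  have hle : μ.rowLen 1 ≤ μ.rowLen 0 := μ.rowLen_anti 0 1 zero_le_one
  have h01 : ∑ i ∈ Finset.range (μ.rowLen 0), ∑ i' ∈ Finset.range (μ.rowLen 1),
      pairSign (0, i) (1, i') = -(μ.rowLen 1 : ℤ) := by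
    rw [Finset.sum_comm]
    have : ∀ i' ∈ Finset.range (μ.rowLen 1), ∑ i ∈ Finset.range (μ.rowLen 0),
        pairSign (0, i) (1, i') = -1 := by
      intro i' hi'
      have : i' < μ.rowLen 0 := (Finset.mem_range.1 hi').trans_le hle
      simp [pairSign, this]
    rw [Finset.sum_congr rfl this]
    simp
  have h10 : ∑ i ∈ Finset.range (μ.rowLen 1), ∑ i' ∈ Finset.range (μ.rowLen 0),
      pairSign (1, i) (0, i') = -(μ.rowLen 1 : ℤ) := by
    rw [Finset.sum_comm, ← h01]
    refine Finset.sum_congr rfl fun i _ => Finset.sum_congr rfl fun i' _ => ?_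
    simp [pairSign, eq_comm]
  simp only [contentSum, sum_cells_of_two_rows hμ, Finset.sum_add_distrib, h01, h10]
  simp [pairSign]
  ring

/-- A diagram with at most two rows is determined by its size and its sum of contents. -/
theorem eq_of_contentSum_eq {μ ν : YoungDiagram} (hμ : (2, 0) ∉ μ) (hν : (2, 0) ∉ ν)
    (hcard : μ.card = ν.card) (h : contentSum μ = contentSum ν) : μ = ν := by
  rw [contentSum_of_two_rows hμ, contentSum_of_two_rows hν] at h
  rw [card_of_two_rows hμ, card_of_two_rows hν] at hcard
  have hμ' : μ.rowLen 1 ≤ μ.rowLen 0 := μ.rowLen_anti 0 1 zero_le_one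
  have hν' : ν.rowLen 1 ≤ ν.rowLen 0 := ν.rowLen_anti 0 1 zero_le_one
  have h1 : μ.rowLen 1 = ν.rowLen 1 := by
    zify at hcard hμ' hν' ⊢
    have h0 : (μ.rowLen 0 : ℤ) = ν.rowLen 0 + ν.rowLen 1 - μ.rowLen 1 := by linarith
    rw [h0] at h hμ'
    -- For equal sizes the difference of the content sums factors like this; the second factor
    -- cannot vanish, as the second row is no longer than the first in both diagrams.
    have hprod : ((μ.rowLen 1 : ℤ) - ν.rowLen 1) * (μ.rowLen 1 - ν.rowLen 0 - 1) = 0 := by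
      linarith
    rcases mul_eq_zero.1 hprod with h2 | h2 <;> linarith
  have h0 : μ.rowLen 0 = ν.rowLen 0 := by omega
  have hmem (ρ : YoungDiagram) (hρ : (2, 0) ∉ ρ) (c : ℕ × ℕ) (hc : c ∈ ρ) : c.1 < 2 := by
    by_contra ha
    exact hρ (ρ.isLowerSet (show ((2, 0) : ℕ × ℕ) ≤ c from ⟨not_lt.1 ha, c.2.zero_le⟩) hc)
  ext ⟨a, b⟩
  rw [YoungDiagram.mem_cells, YoungDiagram.mem_cells]
  by_cases ha : a < 2
  · rw [YoungDiagram.mem_iff_lt_rowLen, YoungDiagram.mem_iff_lt_rowLen]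
    interval_cases a
    · rw [h0]
    · rw [h1]
  · exact ⟨fun h => absurd (hmem μ hμ _ h) ha, fun h => absurd (hmem ν hν _ h) ha⟩

theorem two_zero_notMem_twoRow (p q : ℕ) (h : q ≤ p) : (2, 0) ∉ twoRow p q h := by
  simp [twoRow, YoungDiagram.mem_ofRowLens]

theorem card_twoRow (p q : ℕ) (h : q ≤ p) : (twoRow p q h).card = p + q := by
  rw [card_of_two_rows (two_zero_notMem_twoRow p q h)]
  congr 1
  · exact YoungDiagram.rowLen_ofRowLens (w := [p, q]) (0 : Fin 2)
  · exact YoungDiagram.rowLen_ofRowLens (w := [p, q]) (1 : Fin 2)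

theorem twoRow_injective {p q p' q' : ℕ} {h : q ≤ p} {h' : q' ≤ p'}
    (heq : twoRow p q h = twoRow p' q' h') : q = q' := by
  have h1 := YoungDiagram.rowLen_ofRowLens (w := [p, q])
    (hw := by simp [List.sortedGE_iff_pairwise, h]) (1 : Fin 2)
  have h2 := YoungDiagram.rowLen_ofRowLens (w := [p', q'])
    (hw := by simp [List.sortedGE_iff_pairwise, h']) (1 : Fin 2)
  have h3 := congrArg (fun ρ => YoungDiagram.rowLen ρ 1) heq
  exact (h1.symm.trans h3).trans h2

/-! ### Raising and lowering operators on functions of finite sets -/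

section RaiseLower

variable {α : Type*} [Fintype α] [DecidableEq α]

theorem sum_ite_mem_eq_sum_ite_notMem {M : Type*} [AddCommMonoid M] (p : α) (g : Finset α → M) :
    ∑ z : Finset α, (if p ∈ z then g z else 0) =
      ∑ z : Finset α, if p ∉ z then g (insert p z) else 0 := by
  rw [← Finset.sum_filter, ← Finset.sum_filter]
  refine Finset.sum_bij' (fun z _ => z.erase p) (fun z _ => insert p z) ?_ ?_ ?_ ?_ ?_
  · simp
  · simp
  · intro z hz
    simp only [Finset.mem_filter, Finset.mem_univ, true_and] at hz
    exact Finset.insert_erase hz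
  · intro z hz
    simp only [Finset.mem_filter, Finset.mem_univ, true_and] at hz
    exact Finset.erase_insert hz
  · intro z hz
    simp only [Finset.mem_filter, Finset.mem_univ, true_and] at hz
    rw [Finset.insert_erase hz]

/-- The `(p, q)` term of `norm_raise_add_eq`. For `p ≠ q` adding `p` and removing `q` commute, so
the first sums agree after reindexing; for `p = q` the sums agree crosswise. -/
theorem raise_raise_add_eq (v : Finset α → ℂ) (p q : α) :
    (∑ z : Finset α, if p ∈ z then if q ∈ z then star (v (z.erase p)) * v (z.erase q) else 0 else 0) +
      (if p = q then ∑ x, if p ∈ x then star (v x) * v x else 0 else 0) =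
    (∑ z : Finset α, if p ∉ z then if q ∉ z then star (v (insert q z)) * v (insert p z) else 0 else 0) +
      (if p = q then ∑ x, if p ∉ x then star (v x) * v x else 0 else 0) := by
  by_cases hpq : p = q
  · subst hpq
    simp only [if_true]
    rw [add_comm]
    congr 1
    · rw [sum_ite_mem_eq_sum_ite_notMem]
      refine Finset.sum_congr rfl fun z _ => ?_
      by_cases h : p ∈ z <;> simp [h]
    · rw [sum_ite_mem_eq_sum_ite_notMem]
      refine Finset.sum_congr rfl fun z _ => ?_
      by_cases h : p ∈ z <;> simp [h]
  · simp only [if_neg hpq, add_zero]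
    rw [sum_ite_mem_eq_sum_ite_notMem]
    have h1 (z : Finset α) : (if p ∉ z then if q ∈ insert p z then
        star (v ((insert p z).erase p)) * v ((insert p z).erase q) else 0 else 0) =
        if q ∈ z then if p ∉ z then star (v z) * v ((insert p z).erase q) else 0 else 0 := by
      have hqp : q ≠ p := fun h => hpq h.symm
      by_cases hp : p ∈ z <;> by_cases hq : q ∈ z <;>
        simp [hp, hq, hqp]
    simp only [h1]
    rw [sum_ite_mem_eq_sum_ite_notMem]
    refine Finset.sum_congr rfl fun z _ => ?_
    by_cases hp : p ∈ z <;> by_cases hq : q ∈ z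
    · simp [hp, hq]
    · simp [hp, hq]
    · simp [hp, hq]
    · have : q ∉ insert p z := by simp [hq, Ne.symm hpq]
      simp [hp, hq, hpq, Finset.insert_comm p q, Finset.erase_insert this]

/-- The commutation relation of the raising and the lowering operator along the places in `A`. -/
theorem norm_raise_add_eq (A : Finset α) (v : Finset α → ℂ) :
    ∑ z : Finset α, ‖∑ q ∈ A with q ∈ z, v (z.erase q)‖ ^ 2 +
        ∑ x, ((A.filter (· ∈ x)).card : ℝ) * ‖v x‖ ^ 2 =
      ∑ z : Finset α, ‖∑ p ∈ A with p ∉ z, v (insert p z)‖ ^ 2 +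
        ∑ x, ((A.filter (· ∉ x)).card : ℝ) * ‖v x‖ ^ 2 := by
  have hn (a : ℂ) : ((‖a‖ ^ 2 : ℝ) : ℂ) = star a * a := by
    rw [← starRingEnd_apply, Complex.conj_mul']
    push_cast
    rfl
  have hsq (S : Finset α) (f : α → ℂ) : star (∑ p ∈ S, f p) * ∑ q ∈ S, f q =
      ∑ p ∈ S, ∑ q ∈ S, star (f p) * f q := by
    rw [star_sum, Finset.sum_mul_sum]
  -- The indices are exchanged for the lowering operator so that both sides match term by term in
  -- `(p, q)`.
  have hsq' (S : Finset α) (f : α → ℂ) : star (∑ p ∈ S, f p) * ∑ q ∈ S, f q =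
      ∑ p ∈ S, ∑ q ∈ S, star (f q) * f p := by
    rw [hsq, Finset.sum_comm]
  have hcount (P : α → Finset α → Prop) [∀ p x, Decidable (P p x)] :
      ∑ x, ((A.filter (P · x)).card : ℂ) * (star (v x) * v x) =
        ∑ p ∈ A, ∑ q ∈ A, if p = q then ∑ x, (if P p x then star (v x) * v x else 0) else 0 := by
    have : ∀ p ∈ A, (∑ q ∈ A, if p = q then ∑ x, (if P p x then star (v x) * v x else 0) else 0) =
        ∑ x, (if P p x then star (v x) * v x else 0) := by
      intro p hp
      rw [Finset.sum_ite_eq, if_pos hp]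
    rw [Finset.sum_congr rfl this, Finset.sum_comm]
    refine Finset.sum_congr rfl fun x _ => ?_
    rw [← Finset.sum_filter, Finset.sum_const, nsmul_eq_mul]
  have h : (∑ z : Finset α, star (∑ q ∈ A with q ∈ z, v (z.erase q)) * ∑ q ∈ A with q ∈ z, v (z.erase q)) +
        ∑ x, ((A.filter (· ∈ x)).card : ℂ) * (star (v x) * v x) =
      (∑ z : Finset α, star (∑ p ∈ A with p ∉ z, v (insert p z)) * ∑ p ∈ A with p ∉ z, v (insert p z)) +
        ∑ x, ((A.filter (· ∉ x)).card : ℂ) * (star (v x) * v x) := by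
    rw [hcount (fun p x => p ∈ x), hcount (fun p x => p ∉ x)]
    have hL : (∑ z : Finset α, star (∑ q ∈ A with q ∈ z, v (z.erase q)) *
        ∑ q ∈ A with q ∈ z, v (z.erase q)) = ∑ p ∈ A, ∑ q ∈ A, ∑ z : Finset α,
          if p ∈ z then if q ∈ z then star (v (z.erase p)) * v (z.erase q) else 0 else 0 := by
      simp only [hsq, Finset.sum_filter]
      rw [Finset.sum_comm]
      refine Finset.sum_congr rfl fun p _ => ?_
      rw [Finset.sum_comm]
      refine Finset.sum_congr rfl fun q _ => Finset.sum_congr rfl fun z _ => ?_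
      by_cases hp : p ∈ z <;> by_cases hq : q ∈ z <;> simp [hp, hq]
    have hR : (∑ z : Finset α, star (∑ p ∈ A with p ∉ z, v (insert p z)) *
        ∑ p ∈ A with p ∉ z, v (insert p z)) = ∑ p ∈ A, ∑ q ∈ A, ∑ z : Finset α,
          if p ∉ z then if q ∉ z then star (v (insert q z)) * v (insert p z) else 0 else 0 := by
      simp only [hsq', Finset.sum_filter]
      rw [Finset.sum_comm]
      refine Finset.sum_congr rfl fun p _ => ?_
      rw [Finset.sum_comm]
      refine Finset.sum_congr rfl fun q _ => Finset.sum_congr rfl fun z _ => ?_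
      by_cases hp : p ∈ z <;> by_cases hq : q ∈ z <;> simp [hp, hq]
    rw [hL, hR]
    simp only [← Finset.sum_add_distrib, raise_raise_add_eq]
  apply Complex.ofReal_injective
  push_cast
  simpa only [← hn, Complex.ofReal_pow] using h

end RaiseLower

/-! ### Dimensions of the Gelfand–Tsetlin spaces -/

/-- The sum of the transpositions of the place `i` with the smaller places. -/
def jucysMurphy (n k : ℕ) (i : Fin n) : F n k →ₗ[ℂ] F n k :=
  ∑ p ∈ Finset.Iio i, rep n k (swap p i)

theorem sum_castLE_eq_sum_Iio {n : ℕ} {M : Type*} [AddCommMonoid M] (i : Fin n) (f : Fin n → M) :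
    ∑ p : Fin i, f (p.castLE i.2.le) = ∑ p ∈ Finset.Iio i, f p := by
  refine Finset.sum_bij (fun p _ => p.castLE i.2.le) ?_ ?_ ?_ ?_
  · intro p _
    exact Finset.mem_Iio.2 p.2
  · intro p _ q _ h
    exact Fin.castLE_injective _ h
  · intro p hp
    have hpi : p < i := Finset.mem_Iio.1 hp
    exact ⟨⟨p, hpi⟩, Finset.mem_univ _, rfl⟩
  · intro p _
    rfl

/-- The new ordered pairs are each transposition with `i` twice, and `(i, i)`, which gives the
identity. -/
theorem swapSum_succ (n k : ℕ) (i : Fin n) (hi : (i : ℕ) + 1 ≤ n) :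
    swapSum n k hi = swapSum n k i.2.le + (2 : ℂ) • jucysMurphy n k i + 1 := by
  have h1 (p : Fin i) : (p.castSucc.castLE hi : Fin n) = p.castLE i.2.le := rfl
  have h2 : (Fin.last (i : ℕ)).castLE hi = i := rfl
  simp only [swapSum, Fin.sum_univ_castSucc, h1, h2, Finset.sum_add_distrib]
  rw [sum_castLE_eq_sum_Iio i (fun p => rep n k (swap p i)),
    sum_castLE_eq_sum_Iio i (fun p => rep n k (swap i p)), swap_self, ← Perm.one_def, map_one,
    jucysMurphy, two_smul]
  simp only [swap_comm i]
  abel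

theorem jucysMurphy_apply (n k : ℕ) (i : Fin n) (f : F n k) (x : X n k) :
    jucysMurphy n k i f x = ∑ p ∈ Finset.Iio i, f (swap p i • x) := by
  simp [jucysMurphy, rep_apply, LinearMap.sum_apply]

/-- The joint eigenspace of the sums of transpositions of the levels up to `i`. -/
def jointEigenspace (n k : ℕ) {i : ℕ} (hi : i ≤ n) (γ : ℕ → ℂ) : Submodule ℂ (F n k) :=
  ⨅ (j : ℕ) (hj : j ≤ i), Module.End.eigenspace (swapSum n k (hj.trans hi)) (γ j)

theorem mem_jointEigenspace {n k i : ℕ} {hi : i ≤ n} {γ : ℕ → ℂ} {f : F n k} :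
    f ∈ jointEigenspace n k hi γ ↔
      ∀ (j : ℕ) (hj : j ≤ i), swapSum n k (hj.trans hi) f = γ j • f := by
  simp [jointEigenspace, Submodule.mem_iInf]

theorem mem_suffixSpace {n k i : ℕ} {w : Set (Fin n)} {f : F n k} :
    f ∈ suffixSpace n k i w ↔
      ∀ x, f x ≠ 0 → ∀ p : Fin n, i ≤ p.val → (p ∈ x.1 ↔ p ∈ w) := by
  rw [suffixSpace, ← OrthonormalBasis.coe_toBasis, Module.Basis.mem_span_image]
  have h (x : X n k) : (deltaBasis n k).toBasis.repr f x = f x := by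
    simp [deltaBasis]
  constructor
  · intro hf x hx
    exact hf (Finsupp.mem_support_iff.2 (by rwa [h]))
  · intro hf x hx
    refine hf x ?_
    rw [← h]
    exact Finsupp.mem_support_iff.1 hx

open Classical in
/-- The restriction of a function to a set of `k`-sets. -/
def cutoff {n k : ℕ} (S : Set (X n k)) : F n k →ₗ[ℂ] F n k where
  toFun f := WithLp.toLp 2 fun x => if x ∈ S then f x else 0
  map_add' f g := by
    ext x
    by_cases h : x ∈ S <;> simp [h]
  map_smul' c f := by
    ext x
    by_cases h : x ∈ S <;> simp [h]

open Classical in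
theorem cutoff_apply {n k : ℕ} (S : Set (X n k)) (f : F n k) (x : X n k) :
    cutoff S f x = if x ∈ S then f x else 0 := rfl

theorem of_cutoff_apply_ne_zero {n k : ℕ} {S : Set (X n k)} {f : F n k} {x : X n k}
    (h : cutoff S f x ≠ 0) : x ∈ S ∧ f x ≠ 0 := by
  rw [cutoff_apply] at h
  split_ifs at h with hx
  · exact ⟨hx, h⟩
  · exact absurd rfl h

theorem cutoff_add_cutoff_compl {n k : ℕ} (S : Set (X n k)) (f : F n k) :
    cutoff S f + cutoff Sᶜ f = f := by
  ext x
  by_cases h : x ∈ S <;> simp [cutoff_apply, h]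

theorem rep_cutoff {n k : ℕ} {S : Set (X n k)} {σ : Perm (Fin n)}
    (h : ∀ x, σ⁻¹ • x ∈ S ↔ x ∈ S) (f : F n k) :
    rep n k σ (cutoff S f) = cutoff S (rep n k σ f) := by
  classical
  ext x
  rw [rep_apply, cutoff_apply, cutoff_apply, rep_apply]
  exact if_congr (h x) rfl rfl

theorem cutoff_mem_jointEigenspace {n k i : ℕ} {hi : i ≤ n} {γ : ℕ → ℂ} {f : F n k}
    (hf : f ∈ jointEigenspace n k hi γ) {S : Set (X n k)}
    (hS : ∀ p q : Fin n, p.val < i → q.val < i → ∀ x, swap p q • x ∈ S ↔ x ∈ S) :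
    cutoff S f ∈ jointEigenspace n k hi γ := by
  rw [mem_jointEigenspace] at hf ⊢
  intro j hj
  rw [← map_smul, ← hf j hj]
  simp only [swapSum, LinearMap.sum_apply, map_sum]
  refine Finset.sum_congr rfl fun p _ => Finset.sum_congr rfl fun q _ => rep_cutoff ?_ f
  intro x
  rw [swap_inv]
  exact hS _ _ (p.2.trans_le hj) (q.2.trans_le hj) x

theorem mem_swap_smul_iff_of_ne {n k : ℕ} {p q i : Fin n} (hp : i ≠ p) (hq : i ≠ q) (x : X n k) :
    i ∈ (swap p q • x).1 ↔ i ∈ x.1 := by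
  rw [mem_smul_iff, swap_inv, swap_apply_of_ne_of_ne hp hq]

/-- A function is split according to the letter at the place `i`. Permutations of the places below
`i` do not move this letter, so both parts remain joint eigenvectors. -/
theorem jointEigenspace_inf_suffixSpace_succ_le (n k : ℕ) (i : Fin n) (γ : ℕ → ℂ)
    (w : Set (Fin n)) :
    jointEigenspace n k i.2.le γ ⊓ suffixSpace n k (i + 1) w ≤
      (jointEigenspace n k i.2.le γ ⊓ suffixSpace n k i (w ∪ {i})) ⊔
        (jointEigenspace n k i.2.le γ ⊓ suffixSpace n k i (w \ {i})) := by
  rintro f ⟨hf, hw⟩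
  rw [SetLike.mem_coe, mem_suffixSpace] at hw
  let S : Set (X n k) := {x | i ∈ x.1}
  have hS : ∀ p q : Fin n, p.val < i → q.val < i → ∀ x, swap p q • x ∈ S ↔ x ∈ S := by
    intro p q hp hq x
    refine mem_swap_smul_iff_of_ne ?_ ?_ x <;> rintro rfl <;> omega
  rw [← cutoff_add_cutoff_compl S f]
  refine Submodule.add_mem_sup ⟨cutoff_mem_jointEigenspace hf hS, ?_⟩
    ⟨cutoff_mem_jointEigenspace hf (fun p q hp hq x => not_congr (hS p q hp hq x)), ?_⟩
  · rw [SetLike.mem_coe, mem_suffixSpace]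
    intro x hx p hp
    obtain ⟨hxS, hx⟩ := of_cutoff_apply_ne_zero hx
    rcases eq_or_ne p i with rfl | hpi
    · exact ⟨fun _ => .inr rfl, fun _ => hxS⟩
    · rw [hw x hx p (by have := Fin.val_ne_of_ne hpi; omega)]
      simp [hpi]
  · rw [SetLike.mem_coe, mem_suffixSpace]
    intro x hx p hp
    obtain ⟨hxS, hx⟩ := of_cutoff_apply_ne_zero hx
    rcases eq_or_ne p i with rfl | hpi
    · exact ⟨fun h => absurd h hxS, fun h => absurd rfl h.2⟩
    · rw [hw x hx p (by have := Fin.val_ne_of_ne hpi; omega)]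
      simp [hpi]

theorem suffixSpace_le_succ (n k i : ℕ) {w w' : Set (Fin n)}
    (h : ∀ p : Fin n, i + 1 ≤ p.val → (p ∈ w ↔ p ∈ w')) :
    suffixSpace n k i w ≤ suffixSpace n k (i + 1) w' := by
  intro f hf
  rw [mem_suffixSpace] at hf ⊢
  intro x hx p hp
  rw [hf x hx p (by omega), h p hp]

open Classical in
/-- The number of elements below `i` of a set whose elements above `i` are given by `w`. -/
theorem card_filter_Iio_mem {n k : ℕ} {i : Fin n} {w : Set (Fin n)} {x : X n k}
    (hx : ∀ p : Fin n, i < p → (p ∈ x.1 ↔ p ∈ w)) :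
    ((Finset.Iio i).filter (· ∈ x.1)).card + (if i ∈ x.1 then 1 else 0) +
      ((Finset.Ioi i).filter (· ∈ w)).card = k := by
  have hk : x.1.card = k := x.2
  have h : x.1 = ((Finset.Iio i).filter (· ∈ x.1) ∪ (if i ∈ x.1 then {i} else ∅)) ∪
      (Finset.Ioi i).filter (· ∈ w) := by
    ext p
    simp only [Finset.mem_union, Finset.mem_filter, Finset.mem_Iio, Finset.mem_Ioi]
    rcases lt_trichotomy p i with h | rfl | h
    · have h1 : ¬ i < p := h.asymm
      by_cases hi : i ∈ x.1 <;> simp [h, h1, hi, h.ne]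
    · by_cases hi : p ∈ x.1 <;> simp [hi]
    · have h1 : ¬ p < i := h.asymm
      by_cases hi : i ∈ x.1 <;> simp [h, h1, hi, h.ne', hx p h]
  refine Eq.trans ?_ hk
  conv_rhs => rw [h]
  rw [Finset.card_union_of_disjoint, Finset.card_union_of_disjoint]
  · by_cases hi : i ∈ x.1 <;> simp [hi]
  · by_cases hi : i ∈ x.1 <;> simp [hi]
  · rw [Finset.disjoint_left]
    intro p hp hp'
    have h2 : i < p := Finset.mem_Ioi.1 (Finset.mem_filter.1 hp').1
    rcases Finset.mem_union.1 hp with hp | hp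
    · exact h2.asymm (Finset.mem_Iio.1 (Finset.mem_filter.1 hp).1)
    · by_cases hi : i ∈ x.1
      · rw [if_pos hi, Finset.mem_singleton] at hp
        exact h2.ne' hp
      · simp [hi] at hp

/-- A function on `k`-sets, extended by zero to all sets. -/
def extend {n k : ℕ} (f : F n k) (s : Finset (Fin n)) : ℂ :=
  if h : s.card = k then f ⟨s, h⟩ else 0

theorem extend_coe {n k : ℕ} (f : F n k) (x : X n k) : extend f x.1 = f x := by
  have h : x.1.card = k := x.2
  rw [extend, dif_pos h]

theorem exists_of_extend_ne_zero {n k : ℕ} {f : F n k} {s : Finset (Fin n)} (h : extend f s ≠ 0) :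
    ∃ x : X n k, x.1 = s ∧ f x ≠ 0 := by
  rw [extend] at h
  split_ifs at h with hs
  · exact ⟨⟨s, hs⟩, rfl, h⟩
  · exact absurd rfl h

theorem coe_swap_smul_of_mem_of_notMem {n k : ℕ} {p i : Fin n} {x : X n k} (hi : i ∈ x.1)
    (hp : p ∉ x.1) : (swap p i • x).1 = insert p (x.1.erase i) := by
  have hpi : p ≠ i := by
    rintro rfl
    exact hp hi
  ext r
  rw [mem_smul_iff, swap_inv, Finset.mem_insert, Finset.mem_erase]
  rcases eq_or_ne r p with rfl | hr
  · simp [hi]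
  rcases eq_or_ne r i with rfl | hr'
  · simp [hp, hr]
  · simp [hr, hr', swap_apply_of_ne_of_ne]

/-- Nonzero functions on the sets that contain the place `i`, and on those that do not, are not
eigenfunctions of the Jucys–Murphy element of `i` for the same eigenvalue. -/
theorem eq_zero_of_jucysMurphy_eq {n k : ℕ} {i : Fin n} {w : Set (Fin n)} {c : ℂ} {u₀ u₁ : F n k}
    (h₀ : ∀ x, u₀ x ≠ 0 → i ∉ x.1) (hw₀ : ∀ x, u₀ x ≠ 0 → ∀ p : Fin n, i < p → (p ∈ x.1 ↔ p ∈ w))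
    (h₁ : ∀ x, u₁ x ≠ 0 → i ∈ x.1) (hw₁ : ∀ x, u₁ x ≠ 0 → ∀ p : Fin n, i < p → (p ∈ x.1 ↔ p ∈ w))
    (hJ₀ : jucysMurphy n k i u₀ = c • u₀) (hJ₁ : jucysMurphy n k i u₁ = c • u₁) (hu₁ : u₁ ≠ 0) :
    u₀ = 0 := by
  classical
  obtain ⟨y, hy⟩ : ∃ y, u₁ y ≠ 0 := by
    by_contra! h
    exact hu₁ (by ext y; exact h y)
  -- At `y`, swaps with `p ∈ y` fix `y`, and the others move `i` out of the set, where `u₁`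
  -- vanishes. For `u₀` the roles of the letters are reversed.
  have hc₁ : c = ((Finset.Iio i).filter (· ∈ y.1)).card := by
    have h := congrArg (fun f : F n k => f y) hJ₁
    simp only [jucysMurphy_apply, PiLp.smul_apply, smul_eq_mul] at h
    have h2 : ∀ p ∈ Finset.Iio i, u₁ (swap p i • y) = if p ∈ y.1 then u₁ y else 0 := by
      intro p hp
      split_ifs with hpy
      · rw [swap_smul_eq_self (by simp [hpy, h₁ y hy])]
      · by_contra hne
        have := h₁ _ hne
        rw [mem_smul_iff, swap_inv, swap_apply_right] at this
        exact hpy this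
    rw [Finset.sum_congr rfl h2, ← Finset.sum_filter, Finset.sum_const, nsmul_eq_mul] at h
    exact (mul_right_cancel₀ hy h).symm
  have hc₀ (x : X n k) (hx : u₀ x ≠ 0) : c = ((Finset.Iio i).filter (· ∉ x.1)).card := by
    have h := congrArg (fun f : F n k => f x) hJ₀
    simp only [jucysMurphy_apply, PiLp.smul_apply, smul_eq_mul] at h
    have h2 : ∀ p ∈ Finset.Iio i, u₀ (swap p i • x) = if p ∉ x.1 then u₀ x else 0 := by
      intro p hp
      split_ifs with hpx
      · by_contra hne
        have := h₀ _ hne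
        rw [mem_smul_iff, swap_inv, swap_apply_right] at this
        exact this hpx
      · rw [swap_smul_eq_self (by simp [hpx, h₀ x hx])]
    rw [Finset.sum_congr rfl h2, ← Finset.sum_filter, Finset.sum_const, nsmul_eq_mul] at h
    exact (mul_right_cancel₀ hx h).symm
  -- Sets in the supports of `u₀` and `u₁` have the same size and agree above `i`, so `x` has one
  -- more element below `i` than `y`, that is, `c + 1`; it misses `c` places there.
  have hcount (x : X n k) (hx : u₀ x ≠ 0) : ((Finset.Iio i).filter (· ∈ x.1)).card =
      ((Finset.Iio i).filter (· ∉ x.1)).card + 1 := by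
    have h1 := card_filter_Iio_mem (hw₀ x hx)
    have h2 := card_filter_Iio_mem (hw₁ y hy)
    rw [if_neg (h₀ x hx)] at h1
    rw [if_pos (h₁ y hy)] at h2
    have h3 : ((Finset.Iio i).filter (· ∉ x.1)).card = ((Finset.Iio i).filter (· ∈ y.1)).card := by
      exact_mod_cast (hc₀ x hx).symm.trans hc₁
    omega
  -- The lowering operator kills `u₀`: its value at `z` is that of `jucysMurphy n k i u₀ = c • u₀`
  -- at `insert i z`, where `u₀` vanishes.
  have hlower (z : Finset (Fin n)) :
      ∑ p ∈ Finset.Iio i with p ∉ z, extend u₀ (insert p z) = 0 := by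
    by_cases hiz : i ∈ z
    · refine Finset.sum_eq_zero fun p _ => ?_
      by_contra hne
      obtain ⟨x, hx, hx0⟩ := exists_of_extend_ne_zero hne
      exact h₀ x hx0 (by rw [hx]; exact Finset.mem_insert_of_mem hiz)
    by_cases hz : z.card + 1 = k
    · have hcard : (insert i z).card = k := by rw [Finset.card_insert_of_notMem hiz, hz]
      let y : X n k := ⟨insert i z, hcard⟩
      have hiy : i ∈ y.1 := Finset.mem_insert_self i z
      have hu : u₀ y = 0 := by
        by_contra hne
        exact h₀ y hne hiy
      have h := congrArg (fun f : F n k => f y) hJ₀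
      simp only [jucysMurphy_apply, PiLp.smul_apply, hu, smul_zero] at h
      rw [← h, Finset.sum_filter]
      refine Finset.sum_congr rfl fun p hp => ?_
      have hpi : p ≠ i := (Finset.mem_Iio.1 hp).ne
      split_ifs with hpz
      · have hpy : p ∈ y.1 := Finset.mem_insert_of_mem hpz
        rw [swap_smul_eq_self (by simp [hiy, hpy]), hu]
      · have hpy : p ∉ y.1 := by simp [y, hpi, hpz]
        have := coe_swap_smul_of_mem_of_notMem hiy hpy
        rw [show y.1.erase i = z from Finset.erase_insert hiz] at this
        rw [← this, extend_coe]
    · refine Finset.sum_eq_zero fun p hp => ?_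
      by_contra hne
      obtain ⟨x, hx, -⟩ := exists_of_extend_ne_zero hne
      have hxk : x.1.card = k := x.2
      rw [hx, Finset.card_insert_of_notMem (Finset.mem_filter.1 hp).2] at hxk
      exact hz hxk
  -- With `hlower` and `hcount` the relation says that the squared norms of the raised function and
  -- of `u₀` add up to zero.
  have key := norm_raise_add_eq (Finset.Iio i) (extend u₀)
  have hsum : ∑ x, (((Finset.Iio i).filter (· ∈ x)).card : ℝ) * ‖extend u₀ x‖ ^ 2 =
      ∑ x, (((Finset.Iio i).filter (· ∉ x)).card : ℝ) * ‖extend u₀ x‖ ^ 2 +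
        ∑ x, ‖extend u₀ x‖ ^ 2 := by
    rw [← Finset.sum_add_distrib]
    refine Finset.sum_congr rfl fun s _ => ?_
    by_cases hs : extend u₀ s = 0
    · simp [hs]
    · obtain ⟨x, rfl, hx⟩ := exists_of_extend_ne_zero hs
      rw [hcount x hx]
      push_cast
      ring
  simp only [hlower, norm_zero] at key
  have h1 : 0 ≤ ∑ z : Finset (Fin n),
      ‖∑ q ∈ Finset.Iio i with q ∈ z, extend u₀ (z.erase q)‖ ^ 2 :=
    Finset.sum_nonneg fun _ _ => by positivity
  have h2 : ∑ x, ‖extend u₀ x‖ ^ 2 ≤ 0 := by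
    rw [hsum] at key
    simp at key
    linarith
  ext x
  have h3 : ‖extend u₀ x.1‖ ^ 2 ≤ 0 :=
    (Finset.single_le_sum (f := fun s => ‖extend u₀ s‖ ^ 2) (fun _ _ => by positivity)
      (Finset.mem_univ x.1)).trans h2
  rw [extend_coe] at h3
  have h4 : ‖u₀ x‖ = 0 := by
    have := norm_nonneg (u₀ x)
    nlinarith
  exact norm_eq_zero.1 h4

/-- The Gelfand–Tsetlin spaces are at most one-dimensional. -/
theorem finrank_jointEigenspace_inf_suffixSpace_le_one (n k : ℕ) {i : ℕ} (hi : i ≤ n)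
    (γ : ℕ → ℂ) (w : Set (Fin n)) :
    Module.finrank ℂ ↥(jointEigenspace n k hi γ ⊓ suffixSpace n k i w) ≤ 1 := by
  induction i generalizing w with
  | zero =>
    refine (Submodule.finrank_mono inf_le_right).trans ?_
    -- At level `0` the suffix is the whole word.
    have hsub : {x : X n k | ∀ p : Fin n, 0 ≤ p.val → (p ∈ x.1 ↔ p ∈ w)}.Subsingleton := by
      intro x hx y hy
      ext p
      exact (hx p p.val.zero_le).trans (hy p p.val.zero_le).symm
    rw [suffixSpace]
    rcases hsub.eq_empty_or_singleton with h | ⟨x, h⟩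
    · rw [h, Set.image_empty, Submodule.span_empty, finrank_bot]
      exact zero_le_one
    · rw [h, Set.image_singleton]
      exact (finrank_span_le_card _).trans (by simp)
  | succ i ih =>
    let I : Fin n := ⟨i, hi⟩
    by_contra! hlt
    set V := jointEigenspace n k hi γ ⊓ suffixSpace n k (i + 1) w with hV
    set V₁ := jointEigenspace n k I.2.le γ ⊓ suffixSpace n k i (w ∪ {I}) with hV₁
    set V₀ := jointEigenspace n k I.2.le γ ⊓ suffixSpace n k i (w \ {I}) with hV₀
    have hle : V ≤ V₁ ⊔ V₀ := by
      refine le_trans ?_ (jointEigenspace_inf_suffixSpace_succ_le n k I γ w)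
      refine inf_le_inf_right _ fun f hf => ?_
      rw [mem_jointEigenspace] at hf ⊢
      exact fun j hj => hf j (Nat.le_succ_of_le hj)
    have h1 : Module.finrank ℂ V₁ ≤ 1 := ih I.2.le _
    have h0 : Module.finrank ℂ V₀ ≤ 1 := ih I.2.le _
    have hadd := Submodule.finrank_add_le_finrank_add_finrank V₁ V₀
    have hmono := Submodule.finrank_mono hle
    -- Dimension at least two forces equality with the sum of the two lines, so vectors of both
    -- lines lie in `V`.
    have heq : V = V₁ ⊔ V₀ := Submodule.eq_of_le_of_finrank_le hle (by omega)
    obtain ⟨u₁, hu₁, hne₁⟩ : ∃ u ∈ V₁, u ≠ 0 := by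
      refine (Submodule.ne_bot_iff _).1 fun h => ?_
      have hz : Module.finrank ℂ V₁ = 0 := by rw [h, finrank_bot]
      omega
    obtain ⟨u₀, hu₀, hne₀⟩ : ∃ u ∈ V₀, u ≠ 0 := by
      refine (Submodule.ne_bot_iff _).1 fun h => ?_
      have hz : Module.finrank ℂ V₀ = 0 := by rw [h, finrank_bot]
      omega
    -- The eigenvalue is obtained by solving `swapSum_succ` for the Jucys–Murphy element.
    have hJ {u : F n k} (hu : u ∈ V) :
        jucysMurphy n k I u = ((γ (i + 1) - γ i - 1) / 2) • u := by
      have hu' := mem_jointEigenspace.1 hu.1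
      have e1 := hu' (i + 1) le_rfl
      have e2 := hu' i (Nat.le_succ i)
      rw [swapSum_succ n k I hi] at e1
      simp only [LinearMap.add_apply, LinearMap.smul_apply, Module.End.one_apply] at e1
      rw [e2] at e1
      rw [div_eq_inv_mul, mul_smul, sub_smul, sub_smul, ← e1, one_smul, eq_inv_smul_iff₀ two_ne_zero]
      abel
    refine hne₀ (eq_zero_of_jucysMurphy_eq (i := I) (w := w) (u₁ := u₁) ?_ ?_ ?_ ?_
      (hJ (heq ▸ Submodule.mem_sup_right hu₀)) (hJ (heq ▸ Submodule.mem_sup_left hu₁)) hne₁)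
    · intro x hx hIx
      exact ((mem_suffixSpace.1 hu₀.2 x hx I le_rfl).1 hIx).2 rfl
    · intro x hx p hp
      rw [mem_suffixSpace.1 hu₀.2 x hx p hp.le]
      simp [hp.ne']
    · intro x hx
      exact (mem_suffixSpace.1 hu₁.2 x hx I le_rfl).2 (.inr rfl)
    · intro x hx p hp
      rw [mem_suffixSpace.1 hu₁.2 x hx p hp.le]
      simp [hp.ne']

/-- The eigenvalues stop at level `i` while the suffix begins one place later: exactly the data that
two non-orthogonal vectors of consecutive levels share. -/
theorem finrank_jointEigenspace_inf_suffixSpace_succ_le_two (n k : ℕ) (i : Fin n) (γ : ℕ → ℂ)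
    (w : Set (Fin n)) :
    Module.finrank ℂ ↥(jointEigenspace n k i.2.le γ ⊓ suffixSpace n k (i + 1) w) ≤ 2 := by
  have h1 := Submodule.finrank_mono (jointEigenspace_inf_suffixSpace_succ_le n k i γ w)
  have h2 := Submodule.finrank_add_le_finrank_add_finrank
    (jointEigenspace n k i.2.le γ ⊓ suffixSpace n k i (w ∪ {i}))
    (jointEigenspace n k i.2.le γ ⊓ suffixSpace n k i (w \ {i}))
  have h3 := finrank_jointEigenspace_inf_suffixSpace_le_one n k i.2.le γ (w ∪ {i})
  have h4 := finrank_jointEigenspace_inf_suffixSpace_le_one n k i.2.le γ (w \ {i})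
  omega

/-! ### The change of basis matrices are sparse -/

theorem inner_rep_left (n k : ℕ) (σ : Perm (Fin n)) (f g : F n k) :
    inner ℂ (rep n k σ f) g = inner ℂ f (rep n k σ⁻¹ g) := by
  rw [PiLp.inner_apply, PiLp.inner_apply, ← Equiv.sum_comp (MulAction.toPerm σ)]
  refine Finset.sum_congr rfl fun x _ => ?_
  rw [rep_apply, rep_apply, MulAction.toPerm_apply, inv_smul_smul, inv_inv]

theorem swapSum_isSymmetric (n k : ℕ) {j : ℕ} (hj : j ≤ n) : (swapSum n k hj).IsSymmetric := by
  intro f g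
  simp only [swapSum, LinearMap.sum_apply, sum_inner, inner_sum, inner_rep_left, swap_inv]

theorem eq_of_inner_ne_zero {n k j : ℕ} {hj : j ≤ n} {f g : F n k} {α β : ℂ}
    (hf : f ∈ Module.End.eigenspace (swapSum n k hj) α)
    (hg : g ∈ Module.End.eigenspace (swapSum n k hj) β) (h : inner ℂ f g ≠ 0) : α = β := by
  by_contra hne
  exact h ((swapSum_isSymmetric n k hj).orthogonalFamily_eigenspaces hne ⟨f, hf⟩ ⟨g, hg⟩)

theorem exists_ne_zero_of_inner_ne_zero {n k : ℕ} {f g : F n k} (h : inner ℂ f g ≠ 0) :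
    ∃ x, f x ≠ 0 ∧ g x ≠ 0 := by
  by_contra! hne
  refine h ?_
  rw [PiLp.inner_apply]
  refine Finset.sum_eq_zero fun x _ => ?_
  by_cases hx : f x = 0
  · rw [hx, inner_zero_left]
  · rw [hne x hx, inner_zero_right]

theorem card_le_of_forall_mem {n k : ℕ} (b : OrthonormalBasis (X n k) ℂ (F n k))
    (V : Submodule ℂ (F n k)) (S : Finset (X n k)) (hS : ∀ x ∈ S, b x ∈ V) :
    S.card ≤ Module.finrank ℂ V := by
  have hli : LinearIndependent ℂ (fun x : S => b x) :=
    b.orthonormal.linearIndependent.comp _ Subtype.val_injective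
  have h := finrank_span_eq_card hli
  rw [Fintype.card_coe] at h
  rw [← h]
  refine Submodule.finrank_mono (Submodule.span_le.2 ?_)
  rintro _ ⟨x, rfl⟩
  exact hS x x.2

/-- An element of a joint eigenspace with a given suffix. -/
def IsGelfandTsetlin {n k i : ℕ} (hi : i ≤ n) (f : F n k) : Prop :=
  ∃ (γ : ℕ → ℂ) (w : Set (Fin n)), f ∈ jointEigenspace n k hi γ ⊓ suffixSpace n k i w

/-- Eigenspaces of the symmetric `swapSum` for different eigenvalues are orthogonal, and so are
functions with disjoint supports; hence the eigenvalues up to level `i` and the suffixes coincide.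
-/
theorem mem_of_inner_ne_zero {n k : ℕ} {i : Fin n} {f g : F n k} {γ γ' : ℕ → ℂ}
    {w w' : Set (Fin n)}
    (hf : f ∈ jointEigenspace n k i.2.le γ ⊓ suffixSpace n k i w)
    (hg : g ∈ jointEigenspace n k (i := i + 1) i.2 γ' ⊓ suffixSpace n k (i + 1) w')
    (h : inner ℂ g f ≠ 0) :
    f ∈ jointEigenspace n k i.2.le γ' ⊓ suffixSpace n k (i + 1) w' ∧
      g ∈ jointEigenspace n k i.2.le γ ⊓ suffixSpace n k (i + 1) w := by
  have hγ (j : ℕ) (hj : j ≤ i) : γ j = γ' j :=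
    (eq_of_inner_ne_zero (Module.End.mem_eigenspace_iff.2
      (mem_jointEigenspace.1 hg.1 j (Nat.le_succ_of_le hj)))
      (Module.End.mem_eigenspace_iff.2 (mem_jointEigenspace.1 hf.1 j hj)) h).symm
  obtain ⟨x, hgx, hfx⟩ := exists_ne_zero_of_inner_ne_zero h
  have hw (p : Fin n) (hp : (i : ℕ) + 1 ≤ p) : p ∈ w ↔ p ∈ w' :=
    (mem_suffixSpace.1 hf.2 x hfx p (by omega)).symm.trans (mem_suffixSpace.1 hg.2 x hgx p hp)
  refine ⟨⟨?_, suffixSpace_le_succ n k i hw hf.2⟩, ?_, ?_⟩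
  · refine mem_jointEigenspace.2 fun j hj => ?_
    rw [← hγ j hj]
    exact mem_jointEigenspace.1 hf.1 j hj
  · refine mem_jointEigenspace.2 fun j hj => ?_
    rw [hγ j hj]
    exact mem_jointEigenspace.1 hg.1 j (Nat.le_succ_of_le hj)
  · refine mem_suffixSpace.2 fun y hy p hp => ?_
    rw [mem_suffixSpace.1 hg.2 y hy p hp, hw p hp]

theorem changeOfBasis_apply {n k : ℕ} (b b' : OrthonormalBasis (X n k) ℂ (F n k)) (x y : X n k) :
    changeOfBasis b b' x y = inner ℂ (b' x) (b y) := by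
  rw [changeOfBasis, Module.Basis.toMatrix_apply, OrthonormalBasis.coe_toBasis_repr_apply,
    OrthonormalBasis.repr_apply_apply]

section Sparse

variable {n k : ℕ} {i : Fin n} {b b' : OrthonormalBasis (X n k) ℂ (F n k)}

-- The vectors `b y` that meet `b' x` are orthonormal in a space of dimension at most two that
-- depends only on `x`.
open Classical in
theorem card_changeOfBasis_row_le_two
    (hb : ∀ y, IsGelfandTsetlin i.2.le (b y))
    (hb' : ∀ x, IsGelfandTsetlin (i := i + 1) i.2 (b' x)) (x : X n k) :
    (Finset.univ.filter fun y => changeOfBasis b b' x y ≠ 0).card ≤ 2 := by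
  obtain ⟨γ', w', hx⟩ := hb' x
  refine (card_le_of_forall_mem b _ _ fun y hy => ?_).trans
    (finrank_jointEigenspace_inf_suffixSpace_succ_le_two n k i γ' w')
  obtain ⟨γ, w, hy'⟩ := hb y
  have h := (Finset.mem_filter.1 hy).2
  rw [changeOfBasis_apply] at h
  exact (mem_of_inner_ne_zero hy' hx h).1

open Classical in
theorem card_changeOfBasis_col_le_two
    (hb : ∀ y, IsGelfandTsetlin i.2.le (b y))
    (hb' : ∀ x, IsGelfandTsetlin (i := i + 1) i.2 (b' x)) (y : X n k) :
    (Finset.univ.filter fun x => changeOfBasis b' b y x ≠ 0).card ≤ 2 := by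
  obtain ⟨γ, w, hy⟩ := hb y
  refine (card_le_of_forall_mem b' _ _ fun x hx => ?_).trans
    (finrank_jointEigenspace_inf_suffixSpace_succ_le_two n k i γ w)
  obtain ⟨γ', w', hx'⟩ := hb' x
  have h := (Finset.mem_filter.1 hx).2
  rw [changeOfBasis_apply] at h
  exact (mem_of_inner_ne_zero hy hx' fun h' => h (inner_eq_zero_symm.1 h')).2

end Sparse

theorem IsIntermediateBases.isGelfandTsetlin {n k : ℕ}
    {B : ℕ → OrthonormalBasis (X n k) ℂ (F n k)} (hB : IsIntermediateBases B) {i : ℕ}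
    (h1 : 1 ≤ i) (hi : i ≤ n) (x : X n k) : IsGelfandTsetlin hi (B i x) := by
  obtain ⟨l, w, -, hx⟩ := hB.gelfandTsetlin i h1 hi x
  -- Level `0` belongs to the joint eigenspace but not to the Young path; there the operator is an
  -- empty sum, with eigenvalue `0`.
  refine ⟨fun j => if j = 0 then 0 else (contentSum (l j) : ℂ), w, ?_, hx.2⟩
  refine mem_jointEigenspace.2 fun j hj => ?_
  rcases Nat.eq_zero_or_pos j with rfl | hj0
  · simp [swapSum]
  · have h := hx.1
    simp only [SetLike.mem_coe, Submodule.mem_iInf] at h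
    rw [if_neg hj0.ne']
    exact Module.End.mem_eigenspace_iff.1 (isotypic_le_eigenspace n k _ _ (h j hj0 hj))

/-! ### The projection to the components -/

/-- The last diagram of the path of `B n x` has at most two rows, so its content sum decides: if it
equals that of `(n - a, a)` the diagrams coincide, otherwise the eigenspaces are orthogonal. -/
theorem IsIntermediateBases.mem_component_or {n k : ℕ}
    {B : ℕ → OrthonormalBasis (X n k) ℂ (F n k)} (hB : IsIntermediateBases B) (hn : 1 ≤ n)
    (a : Fin (min k (n - k) + 1)) (x : X n k) :
    B n x ∈ component n k a ∨ B n x ∈ (component n k a)ᗮ := by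
  obtain ⟨l, w, hl, hx⟩ := hB.gelfandTsetlin n hn le_rfl x
  have h := hx.1
  simp only [SetLike.mem_coe, Submodule.mem_iInf] at h
  replace h : B n x ∈ isotypic n k le_rfl (l n) := h n hn le_rfl
  have hrows : (2, 0) ∉ l n := by
    intro hmem
    rw [isotypic_eq_bot n k le_rfl hmem] at h
    exact (B n).orthonormal.ne_zero x h
  have ha := a.2
  have hrow : (a : ℕ) ≤ n - a := by omega
  change B n x ∈ isotypic n k le_rfl (twoRow (n - a) a hrow) ∨
    B n x ∈ (isotypic n k le_rfl (twoRow (n - a) a hrow))ᗮ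
  by_cases hc : contentSum (twoRow (n - a) a hrow) = contentSum (l n)
  · left
    have hcard : (twoRow (n - a) a hrow).card = (l n).card := by
      rw [card_twoRow, hl.1 n hn le_rfl]
      omega
    rwa [eq_of_contentSum_eq (two_zero_notMem_twoRow _ _ _) hrows hcard hc]
  · right
    rw [Submodule.mem_orthogonal]
    intro g hg
    by_contra hne
    have := eq_of_inner_ne_zero (isotypic_le_eigenspace n k _ _ hg)
      (isotypic_le_eigenspace n k _ _ h) hne
    exact hc (by exact_mod_cast this)

theorem eq_of_mem_component {n k : ℕ} {a a' : Fin (min k (n - k) + 1)} {f : F n k} (hf : f ≠ 0)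
    (ha : f ∈ component n k a) (ha' : f ∈ component n k a') : a = a' := by
  have h1 := a.2
  have h2 := a'.2
  have hc := eq_of_inner_ne_zero (isotypic_le_eigenspace n k _ _ ha)
    (isotypic_le_eigenspace n k _ _ ha') (inner_self_ne_zero.2 hf)
  have h : (a : ℕ) ≤ n - a := by omega
  have h' : (a' : ℕ) ≤ n - a' := by omega
  have heq : twoRow (n - a) a h = twoRow (n - a') a' h' :=
    eq_of_contentSum_eq (two_zero_notMem_twoRow _ _ _) (two_zero_notMem_twoRow _ _ _)
      (by rw [card_twoRow, card_twoRow]; omega) (by exact_mod_cast hc)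
  exact Fin.ext (twoRow_injective heq)

-- Orthogonal projections are self-adjoint and send each `B n x` to itself or to zero; at most one
-- `a ∈ H` contributes, by `eq_of_mem_component`.
open Classical in
theorem IsIntermediateBases.repr_part {n k : ℕ} {B : ℕ → OrthonormalBasis (X n k) ℂ (F n k)}
    (hB : IsIntermediateBases B) (hn : 1 ≤ n) (H : Finset (Fin (min k (n - k) + 1))) (f : F n k)
    (x : X n k) : (B n).repr (part H f) x =
      if ∃ a ∈ H, B n x ∈ component n k a then (B n).repr f x else 0 := by
  have hterm (a : Fin (min k (n - k) + 1)) :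
      inner ℂ (B n x) ((component n k a).starProjection f) =
        if B n x ∈ component n k a then inner ℂ (B n x) f else 0 := by
    rw [← Submodule.inner_starProjection_left_eq_right]
    split_ifs with h
    · rw [Submodule.starProjection_eq_self_iff.2 h]
    · rw [(component n k a).starProjection_apply_eq_zero_iff.2
        ((hB.mem_component_or hn a x).resolve_left h), inner_zero_left]
  rw [OrthonormalBasis.repr_apply_apply, OrthonormalBasis.repr_apply_apply, part, inner_sum]
  simp only [hterm]
  split_ifs with h
  · obtain ⟨a, ha, hax⟩ := h
    rw [Finset.sum_eq_single_of_mem a ha, if_pos hax]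
    intro a' _ hne
    rw [if_neg]
    intro ha'x
    exact hne (eq_of_mem_component ((B n).orthonormal.ne_zero x) ha'x hax)
  · refine Finset.sum_eq_zero fun a ha => if_neg fun hax => h ⟨a, ha, hax⟩

/-! ### The algorithm -/

theorem changeOfBasis_mulVec_repr {n k : ℕ} (b b' : OrthonormalBasis (X n k) ℂ (F n k))
    (f : F n k) : (changeOfBasis b b').mulVec (b.repr f) = b'.repr f :=
  b.toBasis.toMatrix_mulVec_repr b'.toBasis f

theorem card_X (n k : ℕ) : Fintype.card (X n k) = n.choose k := by
  rw [← Nat.card_eq_fintype_card, Set.powersetCard.card, Nat.card_eq_fintype_card, Fintype.card_fin]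

section Algorithm

variable {n k : ℕ} {B : ℕ → OrthonormalBasis (X n k) ℂ (F n k)}

theorem zero_mem_knownConstants : (0 : ℂ) ∈ knownConstants B := .inl (.inl rfl)

open Circuit

/-- The coordinates in `B (i + 1)` are computed from those in `B i`. -/
theorem IsIntermediateBases.computes_succ (hB : IsIntermediateBases B) [Nonempty (X n k)]
    {i m : ℕ} (h1 : 1 ≤ i) (hi : i < n) {φ : (X n k → ℂ) → F n k}
    (h : Computes (knownConstants B) m (fun v => ⇑((B i).repr (φ v)))) :
    Computes (knownConstants B) (m + 2 * n.choose k) (fun v => ⇑((B (i + 1)).repr (φ v))) := by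
  have := h.mulVec zero_mem_knownConstants (changeOfBasis (B i) (B (i + 1)))
    (fun x y => .inr ⟨i + 1, by omega, by omega, x, y, .inl rfl⟩)
    (card_changeOfBasis_row_le_two (i := ⟨i, hi⟩) (hB.isGelfandTsetlin h1 hi.le)
      (hB.isGelfandTsetlin (by omega) hi))
  simpa only [changeOfBasis_mulVec_repr, card_X] using this

/-- The coordinates in `B i` are computed from those in `B (i + 1)`. -/
theorem IsIntermediateBases.computes_pred (hB : IsIntermediateBases B) [Nonempty (X n k)]
    {i m : ℕ} (h1 : 1 ≤ i) (hi : i < n) {φ : (X n k → ℂ) → F n k}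
    (h : Computes (knownConstants B) m (fun v => ⇑((B (i + 1)).repr (φ v)))) :
    Computes (knownConstants B) (m + 2 * n.choose k) (fun v => ⇑((B i).repr (φ v))) := by
  have := h.mulVec zero_mem_knownConstants (changeOfBasis (B (i + 1)) (B i))
    (fun x y => .inr ⟨i + 1, by omega, by omega, x, y, .inr rfl⟩)
    (card_changeOfBasis_col_le_two (i := ⟨i, hi⟩) (hB.isGelfandTsetlin h1 hi.le)
      (hB.isGelfandTsetlin (by omega) hi))
  simpa only [changeOfBasis_mulVec_repr, card_X] using this

theorem IsIntermediateBases.computes_of_le (hB : IsIntermediateBases B) [Nonempty (X n k)]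
    {m : ℕ} {φ : (X n k → ℂ) → F n k}
    (h : Computes (knownConstants B) m (fun v => ⇑((B 1).repr (φ v)))) (i : ℕ) (hi : i + 1 ≤ n) :
    Computes (knownConstants B) (m + 2 * i * n.choose k)
      (fun v => ⇑((B (i + 1)).repr (φ v))) := by
  induction i with
  | zero => simpa using h
  | succ i ih =>
    convert hB.computes_succ (by omega) (by omega) (ih (by omega)) using 1
    ring

theorem IsIntermediateBases.computes_one (hB : IsIntermediateBases B) [Nonempty (X n k)]
    {φ : (X n k → ℂ) → F n k} (i : ℕ) (hi : i + 1 ≤ n) {m : ℕ}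
    (h : Computes (knownConstants B) m (fun v => ⇑((B (i + 1)).repr (φ v)))) :
    Computes (knownConstants B) (m + 2 * i * n.choose k) (fun v => ⇑((B 1).repr (φ v))) := by
  induction i generalizing m with
  | zero => simpa using h
  | succ i ih =>
    convert ih (by omega) (hB.computes_pred (by omega) (by omega) h) using 1
    ring

end Algorithm

end Johnson

end

/-! ### The circuit that computes `f_H` -/

theorem mainTheorem3 (n k : ℕ) (hn : 1 ≤ n) (hk : k ≤ n)
    (B : ℕ → OrthonormalBasis (Johnson.X n k) ℂ (Johnson.F n k))
    (hB : Johnson.IsIntermediateBases B)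
    (H : Finset (Fin (min k (n - k) + 1))) :
    ∃ P : Johnson.Circuit (Johnson.X n k) (Johnson.X n k),
      P.ConstantsIn (Johnson.knownConstants B) ∧
      P.cost ≤ 4 * (n - 1) * n.choose k ∧
      ∀ f : Johnson.F n k, P.eval ((B 0).repr f) = (B 0).repr (Johnson.part H f) := by
  classical
  have hne : Nonempty (Johnson.X n k) := by
    rw [← Fintype.card_pos_iff, Johnson.card_X]
    exact Nat.choose_pos hk
  let φ : (Johnson.X n k → ℂ) → Johnson.F n k := fun v => (B 0).repr.symm (WithLp.toLp 2 v)
  have h10 : B 1 = B 0 := hB.one.trans hB.zero.symm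
  obtain ⟨m, rfl⟩ : ∃ m, n = m + 1 := ⟨n - 1, by omega⟩
  have hstart : Johnson.Circuit.Computes (Johnson.knownConstants B) 0
      (fun v => ⇑((B 1).repr (φ v))) := by
    convert Johnson.Circuit.computes_id (Johnson.knownConstants B) using 2 with v
    simp [φ, h10]
  -- The projection to `f_H` erases coordinates in `B n`, at no cost.
  have hmid := (hB.computes_of_le hstart m le_rfl).select Johnson.zero_mem_knownConstants
    (fun x => if ∃ a ∈ H, B (m + 1) x ∈ Johnson.component (m + 1) k a then some x else none)
  have hpart : Johnson.Circuit.Computes (Johnson.knownConstants B)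
      (0 + 2 * m * (m + 1).choose k) (fun v => ⇑((B (m + 1)).repr (Johnson.part H (φ v)))) := by
    convert hmid using 1
    funext v x
    rw [hB.repr_part hn]
    split_ifs <;> rfl
  obtain ⟨P, hK, hcost, -, heval⟩ := hB.computes_one m le_rfl hpart
  refine ⟨P, hK, hcost.le.trans (le_of_eq ?_), fun f => ?_⟩
  · rw [Nat.add_sub_cancel]
    ring
  · rw [heval, h10]
    simp [φ]
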